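/- **Setting.** Let $q\in\mathbb C$ with $|q|>1$, fix a logarithm $\ell$ of $q$ (so $e^{\ell}=q$) and put $q^{z}:=e^{z\ell}$ for $z\in\mathbb C$. Let $a\in\mathbb C$ (the framing; in particular $a$ may be any integer). Put $[n]=q^{n/2}-q^{-n/2}$, $[n]!=[1][2]\cdots[n]$ (with $[0]!=1$), and $q^\rho=(q^{-1/2},q^{-3/2},q^{-5/2},\dots)$. For a partition $\mu$ let $\kappa_\mu=\sum_i\mu_i(\mu_i-2i+1)$, let $s_\mu$ be the Schur function (the sum of the monomials $x^T$ over semistandard Young tableaux $T$ of shape $\mu$), and write $\mu=(m_1,\dots,m_k\,|\,n_1,\dots,n_k)$ in Frobenius notation: $k$ is the number of diagonal boxes, $m_i=\mu_i-i$, $n_i=\mu^t_i-i$. For integers $m,n\ge 0$ let $$A_{mn}(q;a)=(-1)^n\,\frac{q^{(2a+1)(m-n)(m+n+1)/4}}{[m+n+1]\,[m]!\,[n]!}.$$ A set $A=\{a_1>a_2>\cdots\}\subset\mathbb Z+\tfrac12$ is *admissible* if $A\cap\mathbb{R}_{>0}$ and $\{r\in\mathbb Z+\tfrac12: r<0\}\setminus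 A$ are finite; its charge is the difference of the two cardinalities (first minus second). The fermionic Fock space $\mathcal F$ is the complex vector space with orthonormal basis $\underline A=\underline{a_1}\wedge\underline{a_2}\wedge\cdots$, $A$ admissible. The operator $\psi_r$ sends $\underline A$ to $(-1)^k\,\underline{a_1}\wedge\cdots\wedge\underline{a_k}\wedge\underline r\wedge\underline{a_{k+1}}\wedge\cdots$ if $r\notin A$ and $a_k>r>a_{k+1}$, and to $0$ if $r\in A$; the operator $\psi_r^*$ sends $\underline A$ to $(-1)^{k+1}\,\underline{A\setminus\{r\}}$ if $r=a_k$, and to $0$ if $r\notin A$. For a partition $\mu$ let $|\mu\rangle=\underline{A_\mu}$ with $A_\mu=\{\mu_i-i+\tfrac12: i\ge 1\}$, and let $|0\rangle$ be the vector of the empty partition. States below are formal, possibly infinite, linear combinations of the basis vectors; $\langle\mu|v\rangle$ is the coefficient of $|\mu\rangle$ in $v$. The operator $X=\sum_{m,n\ge 0}A_{mn}(q;a)\,\psi_{m+1/2}\psi^*_{-n-1/2}$ and its exponential $\exp(X)=\sum_{k\ge0}X^k/k!$ act on such combinations, each coefficient of the result being a finite sum. **Theorem (one-legged case of the Framed ADKMV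 Conjecture).** For every partition $\mu$ the series defining $s_\mu(q^\rho)$ converges absolutely. The framed one-legged vertex state $$V^{(a)}(q)=\sum_\mu q^{a\kappa_\mu/2}\,s_\mu(q^\rho)\,|\mu\rangle$$ lies in the (completed) charge-$0$ subspace of the Fock space, and $$V^{(a)}(q)=\exp\Bigl(\sum_{m,n\ge0}A_{mn}(q;a)\,\psi_{m+\frac12}\psi^*_{-n-\frac12}\Bigr)|0\rangle .$$ In terms of coefficients, for every partition $\mu=(m_1,\dots,m_k\,|\,n_1,\dots,n_k)$, $$q^{a\kappa_\mu/2}s_\mu(q^\rho)=\Bigl\langle\mu\Bigr|\exp\Bigl(\sum_{m,n\ge0}A_{mn}(q;a)\,\psi_{m+\frac12}\psi^*_{-n-\frac12}\Bigr)\Bigl|0\Bigr\rangle=(-1)^{n_1+\cdots+n_k}\det\bigl(A_{m_in_j}(q;a)\bigr)_{1\le i,j\le k}.$$ -/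

import Mathlib

noncomputable section

namespace FramedVertex

/-! ### Partitions -/

/-- `κ_μ = ∑ᵢ μᵢ (μᵢ - 2 i + 1)`, rows numbered from `1` (so row `i` of Mathlib is row `i + 1`). -/
def kappa (μ : YoungDiagram) : ℤ :=
  ∑ i ∈ Finset.range (μ.colLen 0), (μ.rowLen i : ℤ) * ((μ.rowLen i : ℤ) - 2 * ((i : ℤ) + 1) + 1)

/-- The number `k` of boxes on the diagonal of `μ`. -/
def diagLen (μ : YoungDiagram) : ℕ := (μ.cells.filter fun c => c.1 = c.2).card

/-- The Frobenius coordinate `mᵢ = μᵢ - i` (rows numbered from `1`). -/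
def frobM (μ : YoungDiagram) (i : Fin (diagLen μ)) : ℕ := μ.rowLen i - (i + 1)

/-- The Frobenius coordinate `nᵢ = μᵗᵢ - i` (columns numbered from `1`). -/
def frobN (μ : YoungDiagram) (i : Fin (diagLen μ)) : ℕ := μ.colLen i - (i + 1)

/-! ### Schur functions and their specialization at `q^ρ` -/

/-- The monomial `x^T = ∏_{c ∈ μ} x_{T(c)}` of a semistandard tableau, with entries in
`0, 1, 2, …`, evaluated at the sequence `x = (x₀, x₁, …)`. -/
def tableauWeight {μ : YoungDiagram} (x : ℕ → ℂ) (T : SemistandardYoungTableau μ) : ℂ :=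
  ∏ c ∈ μ.cells, x (T c.1 c.2)

/-- The Schur function `s_μ = ∑_T x^T` evaluated at the sequence `x`. -/
def schurEval (μ : YoungDiagram) (x : ℕ → ℂ) : ℂ :=
  ∑' T : SemistandardYoungTableau μ, tableauWeight x T

/-- `q ^ z` for the branch of the power given by the logarithm `ℓ` of `q`. -/
def qpow (ℓ z : ℂ) : ℂ := Complex.exp (z * ℓ)

/-- The sequence `q^ρ = (q^{-1/2}, q^{-3/2}, …)`. -/
def qRho (ℓ : ℂ) (i : ℕ) : ℂ := qpow ℓ (-((2 * (i : ℂ) + 1) / 2))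

/-- `[n] = q^{n/2} - q^{-n/2}`. -/
def qBracket (ℓ : ℂ) (n : ℕ) : ℂ := qpow ℓ ((n : ℂ) / 2) - qpow ℓ (-((n : ℂ) / 2))

/-- `[n]! = [1] [2] ⋯ [n]`. -/
def qFactorial (ℓ : ℂ) (n : ℕ) : ℂ := ∏ k ∈ Finset.range n, qBracket ℓ (k + 1)

/-- `A_{mn}(q;a) = (-1)^n q^{(2a+1)(m-n)(m+n+1)/4} / ([m+n+1] [m]! [n]!)`. -/
def vertexCoeff (ℓ a : ℂ) (m n : ℕ) : ℂ :=
  (-1) ^ n * qpow ℓ ((2 * a + 1) * ((m : ℂ) - n) * ((m : ℂ) + n + 1) / 4) /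
    (qBracket ℓ (m + n + 1) * qFactorial ℓ m * qFactorial ℓ n)

/-! ### The fermionic Fock space

The half-integer `n + 1/2` is represented by the integer `n`.  Hence the negative half-integers
are represented by `Set.Iio 0`, and `-n - 1/2` is represented by `-n - 1`. -/

/-- Admissible sets of half-integers. -/
def IsAdmissible (A : Set ℤ) : Prop := (Set.Iio 0 \ A).Finite ∧ (A \ Set.Iio 0).Finite

theorem IsAdmissible.insert {A : Set ℤ} (hA : IsAdmissible A) (r : ℤ) :
    IsAdmissible (insert r A) := by
  refine ⟨hA.1.subset fun x hx => ⟨hx.1, fun h => hx.2 (Or.inr h)⟩,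
    (hA.2.insert r).subset ?_⟩
  rintro x ⟨rfl | hx, hx'⟩
  · exact Or.inl rfl
  · exact Or.inr ⟨hx, hx'⟩

theorem IsAdmissible.erase {A : Set ℤ} (hA : IsAdmissible A) (r : ℤ) :
    IsAdmissible (A \ {r}) := by
  refine ⟨(hA.1.insert r).subset ?_, hA.2.subset fun x hx => ⟨hx.1.1, hx.2⟩⟩
  rintro x ⟨hx, hx'⟩
  by_cases h : x = r
  · exact Or.inl h
  · exact Or.inr ⟨hx, fun hA' => hx' ⟨hA', h⟩⟩

/-- The type of admissible sets, which index the basis vectors `a₁ ∧ a₂ ∧ ⋯`. -/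
abbrev AdmissibleSet := {A : Set ℤ // IsAdmissible A}

namespace AdmissibleSet

/-- `A ∪ {r}`. -/
def insert (A : AdmissibleSet) (r : ℤ) : AdmissibleSet := ⟨Insert.insert r A.1, A.2.insert r⟩

/-- `A \ {r}`. -/
def erase (A : AdmissibleSet) (r : ℤ) : AdmissibleSet := ⟨A.1 \ {r}, A.2.erase r⟩

/-- The charge `|A \ ℤ₋+1/2| - |ℤ₋+1/2 \ A|`. -/
def charge (A : AdmissibleSet) : ℤ := ((A.1 \ Set.Iio 0).ncard : ℤ) - (Set.Iio 0 \ A.1).ncard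

end AdmissibleSet

/-- The fermionic Fock space: finite linear combinations of the basis vectors. -/
abbrev Fock := AdmissibleSet →₀ ℂ

open Classical in
/-- `ψ_r` inserts `r` between `a_k > r > a_{k+1}` with the sign `(-1)^k`. -/
def psi (r : ℤ) : Fock →ₗ[ℂ] Fock :=
  Finsupp.linearCombination ℂ fun A : AdmissibleSet =>
    if r ∈ A.1 then 0
    else Finsupp.single (A.insert r) ((-1 : ℂ) ^ {s ∈ A.1 | r < s}.ncard)

open Classical in
/-- `ψ*_r` removes `a_k = r` with the sign `(-1)^{k+1}`. -/
def psiStar (r : ℤ) : Fock →ₗ[ℂ] Fock :=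
  Finsupp.linearCombination ℂ fun A : AdmissibleSet =>
    if r ∈ A.1 then
      Finsupp.single (A.erase r) ((-1 : ℂ) ^ ({s ∈ A.1 | r ≤ s}.ncard + 1))
    else 0

/-- The operator `ψ_{m+1/2} ψ*_{-n-1/2}`. -/
def psiPair (m n : ℕ) : Fock →ₗ[ℂ] Fock := psi (m : ℤ) ∘ₗ psiStar (-(n : ℤ) - 1)

/-- The completed Fock space: arbitrary formal linear combinations of the basis vectors;
`v A` is the coefficient of the basis vector of `A`. -/
abbrev CompletedFock := AdmissibleSet → ℂ

/-- The completed charge `0` subspace. -/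
def chargeZero : Submodule ℂ CompletedFock where
  carrier := {v | ∀ A : AdmissibleSet, A.charge ≠ 0 → v A = 0}
  add_mem' := fun hv hw A hA => by simp [hv A hA, hw A hA]
  zero_mem' := fun _ _ => rfl
  smul_mem' := fun c v hv A hA => by simp [hv A hA]

/-- The extension to formal linear combinations of an operator whose matrix has only finitely
many nonzero entries in each row. -/
def extend (T : Fock →ₗ[ℂ] Fock) (v : CompletedFock) : CompletedFock := fun A =>
  ∑ᶠ B : AdmissibleSet, v B * T (Finsupp.single B 1) A

/-- The operator `∑_{m,n ≥ 0} c_{mn} ψ_{m+1/2} ψ*_{-n-1/2}` on formal linear combinations.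
Each coefficient of the result is a finite sum, see `quadOp_finite`. -/
def quadOp (c : ℕ → ℕ → ℂ) (v : CompletedFock) : CompletedFock := fun A =>
  ∑ᶠ p : ℕ × ℕ, c p.1 p.2 * extend (psiPair p.1 p.2) v A

/-- `exp (X) v = ∑_k X^k v / k!`, coefficientwise.  For `X = quadOp c` each coefficient of the
result is a finite sum, see `expOp_finite`. -/
def expOp (X : CompletedFock → CompletedFock) (v : CompletedFock) : CompletedFock := fun A =>
  ∑ᶠ k : ℕ, (k.factorial : ℂ)⁻¹ * (X^[k] v) A

/-- The admissible set `A_μ = {μᵢ - i + 1/2 : i ≥ 1}` of a partition. -/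
def partitionSet (μ : YoungDiagram) : AdmissibleSet :=
  ⟨Set.range fun i : ℕ => (μ.rowLen i : ℤ) - (i + 1), by
    have h0 : ∀ i, μ.colLen 0 ≤ i → μ.rowLen i = 0 := fun i hi => by
      by_contra h
      have : (i, 0) ∈ μ := YoungDiagram.mem_iff_lt_rowLen.2 (Nat.pos_of_ne_zero h)
      exact absurd (YoungDiagram.mem_iff_lt_colLen.1 this) (not_lt.2 hi)
    constructor
    · refine (Set.finite_Ico (-(μ.colLen 0 : ℤ)) 0).subset ?_
      rintro x ⟨hx, hx'⟩
      refine ⟨?_, hx⟩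
      by_contra h
      have hx0 : x < 0 := hx
      refine hx' ⟨(-x - 1).toNat, ?_⟩
      have := h0 (-x - 1).toNat (by omega)
      simp only [this]
      omega
    · refine ((Finset.range (μ.colLen 0)).finite_toSet.image
        fun i : ℕ => (μ.rowLen i : ℤ) - (i + 1)).subset ?_
      rintro x ⟨⟨i, rfl⟩, hx⟩
      refine ⟨i, ?_, rfl⟩
      by_contra h
      have := h0 i (by simpa using h)
      refine hx ?_
      simp only [Set.mem_Iio, this]
      omega⟩

/-- The basis vector `|μ⟩`. -/
def ket (μ : YoungDiagram) : Fock := Finsupp.single (partitionSet μ) 1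

/-- The vacuum `|0⟩`. -/
def vac : Fock := ket ⊥

/-- `⟨μ|v⟩`, the inner product of `|μ⟩` with `v` for which the basis is orthonormal. -/
def bra (μ : YoungDiagram) (v : CompletedFock) : ℂ := v (partitionSet μ)

/-- The framed one-legged vertex state `V^{(a)}(q) = ∑_μ q^{a κ_μ / 2} s_μ(q^ρ) |μ⟩`. -/
def vertexState (ℓ a : ℂ) : CompletedFock := fun A =>
  ∑ᶠ μ : YoungDiagram, qpow ℓ (a * (kappa μ : ℂ) / 2) * schurEval μ (qRho ℓ) * ket μ A

/-! ### The sums in `vertexState`, `extend`, `quadOp` and `expOp` are finite -/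

theorem exists_ne_zero_of_finsum {ι : Type*} {f : ι → ℂ} (h : ∑ᶠ i, f i ≠ 0) :
    ∃ i, f i ≠ 0 := by
  by_contra! h'
  exact h (by simp [h'])

theorem partitionSet_injective : Function.Injective partitionSet := by
  have key : ∀ μ : YoungDiagram, StrictAnti fun i : ℕ => (μ.rowLen i : ℤ) - (i + 1) :=
    fun μ i j hij => by
      have := μ.rowLen_anti i j hij.le
      simp only
      omega
  intro μ ν h
  have hr : ∀ i, μ.rowLen i = ν.rowLen i := by
    have h' := (StrictMono.range_inj (fun _ _ hij => neg_lt_neg (key μ hij))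
      (fun _ _ hij => neg_lt_neg (key ν hij))).1 (by
        have := congrArg (fun s : AdmissibleSet => (fun x : ℤ => -x) '' s.1) h
        simpa only [partitionSet, ← Set.range_comp, Function.comp_def] using this)
    intro i
    have := congrFun h' i
    simp only at this
    omega
  ext ⟨i, j⟩
  rw [YoungDiagram.mem_cells, YoungDiagram.mem_cells, YoungDiagram.mem_iff_lt_rowLen,
    YoungDiagram.mem_iff_lt_rowLen, hr]

theorem vertexState_finite (f : YoungDiagram → ℂ) (A : AdmissibleSet) :
    (Function.support fun μ => f μ * ket μ A).Finite := by
  classical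
  refine Set.Subsingleton.finite fun μ hμ ν hν => partitionSet_injective ?_
  have key : ∀ τ : YoungDiagram, f τ * ket τ A ≠ 0 → partitionSet τ = A := fun τ hτ => by
    by_contra hne
    simp [ket, hne] at hτ
  exact (key μ hμ).trans (key ν hν).symm

theorem psi_single (r : ℤ) (A B : AdmissibleSet) (h : psi r (Finsupp.single B 1) A ≠ 0) :
    r ∉ B.1 ∧ B.insert r = A := by
  classical
  by_cases hr : r ∈ B.1
  · simp [psi, hr] at h
  · refine ⟨hr, ?_⟩
    by_contra hne
    simp [psi, hr, hne] at h

theorem psiPair_single (m n : ℕ) (A B : AdmissibleSet)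
    (h : psiPair m n (Finsupp.single B 1) A ≠ 0) :
    (m : ℤ) ∈ A.1 ∧ -(n : ℤ) - 1 ∉ A.1 ∧ B = (A.erase m).insert (-(n : ℤ) - 1) := by
  classical
  by_cases hs : -(n : ℤ) - 1 ∈ B.1
  · have h' : psi (m : ℤ) (Finsupp.single (B.erase (-(n : ℤ) - 1)) 1) A ≠ 0 := by
      intro h0
      apply h
      have : psiStar (-(n : ℤ) - 1) (Finsupp.single B 1) =
          ((-1 : ℂ) ^ ({s ∈ B.1 | -(n : ℤ) - 1 ≤ s}.ncard + 1)) •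
            Finsupp.single (B.erase (-(n : ℤ) - 1)) 1 := by
        simp only [psiStar, Finsupp.linearCombination_single, one_smul, if_pos hs,
          Finsupp.smul_single, smul_eq_mul, mul_one]
      rw [psiPair, LinearMap.comp_apply, this, map_smul, Finsupp.smul_apply, h0, smul_zero]
    obtain ⟨h1, rfl⟩ := psi_single _ _ _ h'
    simp only [AdmissibleSet.insert, AdmissibleSet.erase, Set.mem_sdiff,
      Set.mem_singleton_iff, Set.mem_insert_iff, not_and, not_not, not_or] at h1 ⊢
    refine ⟨Or.inl trivial, ⟨by omega, fun _ => trivial⟩, ?_⟩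
    apply Subtype.ext
    ext x
    simp only [Set.mem_sdiff, Set.mem_singleton_iff, Set.mem_insert_iff]
    constructor
    · intro hx
      by_cases hx' : x = -(n : ℤ) - 1
      · exact Or.inl hx'
      · refine Or.inr ⟨Or.inr ⟨hx, hx'⟩, ?_⟩
        rintro rfl
        have := h1 hx
        omega
    · rintro (rfl | ⟨rfl | hx, hx'⟩)
      · exact hs
      · exact absurd rfl hx'
      · exact hx.1
  · simp [psiPair, psiStar, hs] at h

theorem extend_psiPair_finite (m n : ℕ) (v : CompletedFock) (A : AdmissibleSet) :
    (Function.support fun B => v B * psiPair m n (Finsupp.single B 1) A).Finite :=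
  (Set.finite_singleton ((A.erase m).insert (-(n : ℤ) - 1))).subset fun _ hB =>
    (psiPair_single m n A _ (right_ne_zero_of_mul hB)).2.2

theorem extend_psiPair_ne_zero (m n : ℕ) (v : CompletedFock) (A : AdmissibleSet)
    (h : extend (psiPair m n) v A ≠ 0) :
    (m : ℤ) ∈ A.1 ∧ -(n : ℤ) - 1 ∉ A.1 ∧ v ((A.erase m).insert (-(n : ℤ) - 1)) ≠ 0 := by
  obtain ⟨B, hB⟩ := exists_ne_zero_of_finsum h
  obtain ⟨h1, h2, rfl⟩ := psiPair_single m n A B (right_ne_zero_of_mul hB)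
  exact ⟨h1, h2, left_ne_zero_of_mul hB⟩

theorem quadOp_finite (c : ℕ → ℕ → ℂ) (v : CompletedFock) (A : AdmissibleSet) :
    (Function.support fun p : ℕ × ℕ => c p.1 p.2 * extend (psiPair p.1 p.2) v A).Finite := by
  have h1 : {m : ℕ | (m : ℤ) ∈ A.1}.Finite :=
    (A.2.2.preimage (f := fun m : ℕ => (m : ℤ)) (Nat.cast_injective.injOn)).subset
      fun m hm => ⟨hm, by simp⟩
  have h2 : {n : ℕ | -(n : ℤ) - 1 ∉ A.1}.Finite :=
    (A.2.1.preimage (f := fun n : ℕ => -(n : ℤ) - 1) (fun x _ y _ h => by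
      simp only at h; omega)).subset fun n hn => ⟨by simp only [Set.mem_Iio]; omega, hn⟩
  refine (h1.prod h2).subset fun p hp => ?_
  have := extend_psiPair_ne_zero _ _ _ _ (right_ne_zero_of_mul hp)
  exact ⟨this.1, this.2.1⟩

theorem quadOp_iterate_ne_zero (c : ℕ → ℕ → ℂ) (v : CompletedFock) (k : ℕ)
    (A : AdmissibleSet) (h : ((quadOp c)^[k] v) A ≠ 0) : k ≤ (A.1 \ Set.Iio 0).ncard := by
  induction k generalizing A with
  | zero => exact Nat.zero_le _
  | succ k ih =>
    rw [Function.iterate_succ_apply'] at h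
    obtain ⟨p, hp⟩ := exists_ne_zero_of_finsum h
    obtain ⟨h1, -, h3⟩ := extend_psiPair_ne_zero _ _ _ _ (right_ne_zero_of_mul hp)
    refine (ih _ h3).trans_lt (Set.ncard_lt_ncard ⟨?_, fun hsub => ?_⟩ A.2.2)
    · rintro x ⟨rfl | hx, hx'⟩
      · exact absurd (show -(p.2 : ℤ) - 1 < 0 by omega) hx'
      · exact ⟨hx.1, hx'⟩
    · obtain ⟨h4 | h4, -⟩ := hsub ⟨h1, by simp⟩
      · omega
      · exact h4.2 rfl

theorem expOp_finite (c : ℕ → ℕ → ℂ) (v : CompletedFock) (A : AdmissibleSet) :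
    (Function.support fun k : ℕ => (k.factorial : ℂ)⁻¹ * ((quadOp c)^[k] v) A).Finite :=
  (Set.finite_Iic (A.1 \ Set.Iio 0).ncard).subset fun k hk =>
    quadOp_iterate_ne_zero c v k A (right_ne_zero_of_mul hk)

end FramedVertex

end

open FramedVertex

noncomputable section

namespace FramedVertex

/-! ### Matrix entries of the fermionic bilinears -/

/-! Both states vanish outside charge 0, and the basis vectors of charge 0 are exactly the `|μ⟩`
(`exists_partitionSet_eq`). It therefore suffices to compute the coefficient at `|μ⟩` on each side;
both are `(-1)^{∑ n_i} det A_{m_i n_j}`.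

Fermionic side: `A_μ` is the vacuum with the holes `-n_j - 1/2` and the particles `m_i + 1/2`. One
application of the quadratic operator pairs a particle with a hole and deletes both, with the signs
of a Laplace expansion. Hence the `k`-th power contributes `k!` times a determinant and every other
power contributes 0 (`quadOp_iterate_vac_frobeniusSet`).

Schur side: for the `n` variables `1, q⁻¹, …, q^{1-n}` the branching rule and geometric sums give
the bialternant formula, a quotient of Vandermonde determinants (`boundedSchur_principal`). Such a
quotient is the determinant of the Lagrange basis at the nodes `q^{n-1-c}`, evaluated at the points
`q^{μ_i+n-i}` (rows from 1). For rows below the diagonal these points are themselves nodes, so the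
matrix has unit rows there and collapses to a `k × k` minor, with a permutation sign `(-1)^{∑ n_i}`
(`det_basis_shiftedRow`). This is Giambelli's formula with explicit hook entries. As `n → ∞` the
entries converge, and rescaling the variables by `q^{-1/2}` turns the limits into `A_{mn}(q;0)`
(`schurEval_qRho`).

Framing: `(m-n)(m+n+1) = m(m+1) - n(n+1)`, so `a` only rescales rows and columns of the determinant,
by a total factor `q^{aκ_μ/2}` (`det_vertexCoeff`). -/

theorem psiStar_apply_single {r : ℤ} {B : AdmissibleSet} (h : r ∈ B.1) :
    psiStar r (Finsupp.single B 1) =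
      ((-1 : ℂ) ^ ({s ∈ B.1 | r ≤ s}.ncard + 1)) • Finsupp.single (B.erase r) 1 := by
  classical
  simp only [psiStar, Finsupp.linearCombination_single, one_smul, if_pos h,
    Finsupp.smul_single, smul_eq_mul, mul_one]

theorem psi_apply_single {r : ℤ} {B : AdmissibleSet} (h : r ∉ B.1) :
    psi r (Finsupp.single B 1) =
      ((-1 : ℂ) ^ {s ∈ B.1 | r < s}.ncard) • Finsupp.single (B.insert r) 1 := by
  classical
  simp only [psi, Finsupp.linearCombination_single, one_smul, if_neg h,
    Finsupp.smul_single, smul_eq_mul, mul_one]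

theorem insert_erase_insert_erase {m n : ℕ} {A : AdmissibleSet} (hm : (m : ℤ) ∈ A.1)
    (hn : -(n : ℤ) - 1 ∉ A.1) :
    (((A.erase m).insert (-(n : ℤ) - 1)).erase (-(n : ℤ) - 1)).insert m = A := by
  apply Subtype.ext
  ext x
  simp only [AdmissibleSet.insert, AdmissibleSet.erase, Set.mem_sdiff,
    Set.mem_singleton_iff, Set.mem_insert_iff]
  constructor
  · rintro (rfl | ⟨rfl | ⟨h, -⟩, h'⟩)
    · exact hm
    · exact absurd rfl h'
    · exact h
  · intro hx
    by_cases h : x = m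
    · exact Or.inl h
    · exact Or.inr ⟨Or.inr ⟨hx, h⟩, fun h' => hn (h' ▸ hx)⟩

/-- The row of `A` in the matrix of `psiPair m n` has a single nonzero entry, in the column of `B`,
so the sum defining `extend` has one term. The exponent adds the signs of removing `-n - 1/2` and
then inserting `m + 1/2`. -/
theorem extend_psiPair {m n : ℕ} {A B : AdmissibleSet} (v : CompletedFock) (hm : (m : ℤ) ∈ A.1)
    (hn : -(n : ℤ) - 1 ∉ A.1) (hB : (A.erase m).insert (-(n : ℤ) - 1) = B) :
    extend (psiPair m n) v A =
      (-1) ^ ({s ∈ B.1 | -(n : ℤ) - 1 ≤ s}.ncard + 1 +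
        {s ∈ (B.erase (-(n : ℤ) - 1)).1 | (m : ℤ) < s}.ncard) * v B := by
  have h1 : -(n : ℤ) - 1 ∈ B.1 := hB ▸ Or.inl rfl
  have h2 : (m : ℤ) ∉ (B.erase (-(n : ℤ) - 1)).1 := by
    subst hB
    rintro ⟨h | h, -⟩
    · omega
    · exact h.2 rfl
  rw [extend, finsum_eq_single _ B]
  · rw [psiPair, LinearMap.comp_apply, psiStar_apply_single h1, map_smul, psi_apply_single h2]
    have h3 : (B.erase (-(n : ℤ) - 1)).insert m = A := by
      rw [← hB, insert_erase_insert_erase hm hn]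
    rw [h3, smul_smul, Finsupp.smul_apply, Finsupp.single_eq_same, smul_eq_mul, mul_one, ← pow_add,
      mul_comm]
  · intro C hC
    by_contra h
    exact hC ((psiPair_single m n A C (right_ne_zero_of_mul h)).2.2.trans hB)

/-- A particle and a hole disappear together. -/
theorem charge_insert_erase {m n : ℕ} {A : AdmissibleSet} (hm : (m : ℤ) ∈ A.1)
    (hn : -(n : ℤ) - 1 ∉ A.1) :
    ((A.erase m).insert (-(n : ℤ) - 1)).charge = A.charge := by
  have h1 : ((A.erase m).insert (-(n : ℤ) - 1)).1 \ Set.Iio 0 = (A.1 \ Set.Iio 0) \ {(m : ℤ)} := by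
    ext x
    simp only [AdmissibleSet.insert, AdmissibleSet.erase, Set.mem_sdiff,
      Set.mem_singleton_iff, Set.mem_insert_iff, Set.mem_Iio]
    constructor
    · rintro ⟨h | h, h'⟩
      · omega
      · exact ⟨⟨h.1, h'⟩, h.2⟩
    · tauto
  have h2 : Set.Iio 0 \ ((A.erase m).insert (-(n : ℤ) - 1)).1 =
      (Set.Iio 0 \ A.1) \ {-(n : ℤ) - 1} := by
    ext x
    simp only [AdmissibleSet.insert, AdmissibleSet.erase, Set.mem_sdiff,
      Set.mem_singleton_iff, Set.mem_insert_iff, Set.mem_Iio, not_or, not_and, not_not]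
    constructor
    · rintro ⟨h, h', h''⟩
      refine ⟨⟨h, fun hx => ?_⟩, h'⟩
      have := h'' hx
      omega
    · tauto
  have h3 := Set.ncard_sdiff_singleton_add_one
    (show (m : ℤ) ∈ A.1 \ Set.Iio 0 from ⟨hm, by simp⟩) A.2.2
  have h4 := Set.ncard_sdiff_singleton_add_one
    (show -(n : ℤ) - 1 ∈ Set.Iio 0 \ A.1 from ⟨by simp only [Set.mem_Iio]; omega, hn⟩) A.2.1
  simp only [AdmissibleSet.charge, h1, h2]
  omega

theorem quadOp_mem_chargeZero (c : ℕ → ℕ → ℂ) {v : CompletedFock} (hv : v ∈ chargeZero) :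
    quadOp c v ∈ chargeZero := by
  intro A hA
  by_contra h
  obtain ⟨p, hp⟩ := exists_ne_zero_of_finsum h
  obtain ⟨h1, h2, h3⟩ := extend_psiPair_ne_zero _ _ _ _ (right_ne_zero_of_mul hp)
  exact h3 (hv _ (by rwa [charge_insert_erase h1 h2]))

theorem expOp_quadOp_mem_chargeZero (c : ℕ → ℕ → ℂ) {v : CompletedFock} (hv : v ∈ chargeZero) :
    expOp (quadOp c) v ∈ chargeZero := by
  have h : ∀ k : ℕ, (quadOp c)^[k] v ∈ chargeZero := fun k => by
    induction k with
    | zero => exact hv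
    | succ k ih =>
      rw [Function.iterate_succ_apply']
      exact quadOp_mem_chargeZero c ih
  intro A hA
  simp only [expOp, h _ A hA, mul_zero, finsum_zero]

/-! ### Admissible sets in Frobenius coordinates -/

/-- The admissible set obtained from the vacuum by removing `-n_j - 1/2` and adding
`m_i + 1/2`. -/
def frobeniusSet {k : ℕ} (m n : Fin k → ℕ) : AdmissibleSet :=
  ⟨{x | (x < 0 ∧ ∀ j, x ≠ -(n j : ℤ) - 1) ∨ ∃ i, x = m i}, by
    constructor
    · refine (Set.finite_range fun j => -(n j : ℤ) - 1).subset ?_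
      rintro x ⟨hx, hx'⟩
      simp only [Set.mem_ofPred_eq, not_or, not_and, not_forall, not_not] at hx'
      obtain ⟨j, hj⟩ := hx'.1 hx
      exact ⟨j, hj.symm⟩
    · refine (Set.finite_range fun i => (m i : ℤ)).subset ?_
      rintro x ⟨hx | ⟨i, hi⟩, hx'⟩
      · exact absurd hx.1 hx'
      · exact ⟨i, hi.symm⟩⟩

theorem mem_frobeniusSet {k : ℕ} {m n : Fin k → ℕ} {x : ℤ} :
    x ∈ (frobeniusSet m n).1 ↔ (x < 0 ∧ ∀ j, x ≠ -(n j : ℤ) - 1) ∨ ∃ i, x = m i := Iff.rfl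

theorem natCast_mem_frobeniusSet {k : ℕ} {m n : Fin k → ℕ} {x : ℕ} :
    (x : ℤ) ∈ (frobeniusSet m n).1 ↔ ∃ i, x = m i := by
  rw [mem_frobeniusSet]
  constructor
  · rintro (h | ⟨i, h⟩)
    · omega
    · exact ⟨i, by exact_mod_cast h⟩
  · rintro ⟨i, rfl⟩
    exact Or.inr ⟨i, rfl⟩

theorem neg_mem_frobeniusSet {k : ℕ} {m n : Fin k → ℕ} {x : ℕ} :
    -(x : ℤ) - 1 ∈ (frobeniusSet m n).1 ↔ ∀ j, x ≠ n j := by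
  rw [mem_frobeniusSet]
  constructor
  · rintro (h | ⟨i, h⟩) j rfl
    · exact h.2 j rfl
    · omega
  · exact fun h => Or.inl ⟨by omega, fun j hj => h j (by omega)⟩

theorem charge_frobeniusSet {k : ℕ} {m n : Fin k → ℕ} (hm : m.Injective) (hn : n.Injective) :
    (frobeniusSet m n).charge = 0 := by
  have h1 : (frobeniusSet m n).1 \ Set.Iio 0 = Set.range fun i => (m i : ℤ) := by
    ext x
    simp only [Set.mem_sdiff, mem_frobeniusSet, Set.mem_Iio, Set.mem_range]
    constructor
    · rintro ⟨h | ⟨i, h⟩, h'⟩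
      · exact absurd h.1 h'
      · exact ⟨i, h.symm⟩
    · rintro ⟨i, rfl⟩
      exact ⟨Or.inr ⟨i, rfl⟩, by omega⟩
  have h2 : Set.Iio 0 \ (frobeniusSet m n).1 = Set.range fun j => -(n j : ℤ) - 1 := by
    ext x
    simp only [Set.mem_sdiff, mem_frobeniusSet, Set.mem_Iio, Set.mem_range, not_or, not_and,
      not_forall, not_not]
    constructor
    · rintro ⟨h, h', -⟩
      obtain ⟨j, hj⟩ := h' h
      exact ⟨j, hj.symm⟩
    · rintro ⟨j, rfl⟩
      exact ⟨by omega, fun _ => ⟨j, rfl⟩, by rintro ⟨i, h⟩; omega⟩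
  rw [AdmissibleSet.charge, h1, h2, Set.ncard_range_of_injective, Set.ncard_range_of_injective,
    sub_self]
  · exact fun i j h => hn (by simpa using h)
  · exact fun i j h => hm (by simpa using h)

theorem frobeniusSet_fin_zero (m n : Fin 0 → ℕ) : frobeniusSet m n = partitionSet ⊥ := by
  have h : ∀ i, (⊥ : YoungDiagram).rowLen i = 0 := fun i => by
    by_contra h
    exact YoungDiagram.notMem_bot _ (YoungDiagram.mem_iff_lt_rowLen.2 (Nat.pos_of_ne_zero h))
  apply Subtype.ext
  ext x
  simp only [mem_frobeniusSet, IsEmpty.forall_iff, and_true, IsEmpty.exists_iff, or_false,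
    partitionSet, h, Set.mem_range]
  constructor
  · exact fun hx => ⟨(-x - 1).toNat, by omega⟩
  · rintro ⟨i, rfl⟩
    omega

/-- Cancelling a particle against a hole deletes one index from each list and keeps the Frobenius
form; this drives the induction on the number of pairs. -/
theorem insert_erase_frobeniusSet {k : ℕ} {m n : Fin (k + 1) → ℕ} (hm : StrictAnti m)
    (hn : StrictAnti n) (i j : Fin (k + 1)) :
    ((frobeniusSet m n).erase (m i)).insert (-(n j : ℤ) - 1) =
      frobeniusSet (m ∘ i.succAbove) (n ∘ j.succAbove) := by
  apply Subtype.ext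
  ext x
  simp only [AdmissibleSet.insert, AdmissibleSet.erase, Set.mem_sdiff, mem_frobeniusSet,
    Set.mem_singleton_iff, Set.mem_insert_iff, Function.comp_apply]
  constructor
  · rintro (rfl | ⟨⟨h1, h2⟩ | ⟨i', rfl⟩, h⟩)
    · refine Or.inl ⟨by omega, fun j' h => ?_⟩
      exact Fin.succAbove_ne j j' (hn.injective (by omega))
    · exact Or.inl ⟨h1, fun j' => h2 _⟩
    · obtain ⟨i'', rfl⟩ := Fin.exists_succAbove_eq (x := i') (y := i)
        (fun h' => h (by rw [h']))
      exact Or.inr ⟨i'', rfl⟩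
  · rintro (⟨h1, h2⟩ | ⟨i', rfl⟩)
    · by_cases hx : x = -(n j : ℤ) - 1
      · exact Or.inl hx
      · refine Or.inr ⟨Or.inl ⟨h1, fun j' hj' => ?_⟩, by omega⟩
        obtain ⟨j'', rfl⟩ := Fin.exists_succAbove_eq (x := j') (y := j)
          (fun h' => hx (by rw [hj', h']))
        exact h2 j'' hj'
    · refine Or.inr ⟨Or.inr ⟨_, rfl⟩, fun h => ?_⟩
      exact Fin.succAbove_ne i i' (hm.injective (by omega))

/-- There are `k` remaining particles and `n j + 1` negative positions from `-n j - 1` on. Of these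
positions, `k - j` are holes, namely those of index above `j`, since `n` decreases. -/
theorem ncard_frobeniusSet_ge {k : ℕ} {m n : Fin (k + 1) → ℕ} (hm : StrictAnti m)
    (hn : StrictAnti n) (i j : Fin (k + 1)) :
    {s ∈ (frobeniusSet (m ∘ i.succAbove) (n ∘ j.succAbove)).1 | -(n j : ℤ) - 1 ≤ s}.ncard =
      n j + 1 + j := by
  classical
  have hneg : Function.Injective fun j' : Fin (k + 1) => -(n j' : ℤ) - 1 :=
    fun a b h => hn.injective (by simpa using h)
  have hpos : Function.Injective fun i' : Fin k => (m (i.succAbove i') : ℤ) :=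
    fun a b h => Fin.succAbove_right_injective (hm.injective (by simpa using h))
  have hset : {s ∈ (frobeniusSet (m ∘ i.succAbove) (n ∘ j.succAbove)).1 | -(n j : ℤ) - 1 ≤ s} =
      ((Finset.univ.image fun i' : Fin k => (m (i.succAbove i') : ℤ)) ∪
        (Finset.Ico (-(n j : ℤ) - 1) 0 \
          (Finset.Ioi j).image fun j' => -(n j' : ℤ) - 1) : Finset ℤ) := by
    ext x
    simp only [Set.mem_ofPred_eq, mem_frobeniusSet, Function.comp_apply, Finset.coe_union,
      Finset.coe_image, Finset.coe_univ, Set.image_univ, Finset.coe_sdiff, Finset.coe_Ico,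
      Set.mem_union, Set.mem_range, Set.mem_sdiff, Set.mem_Ico, Set.mem_image, Finset.coe_Ioi,
      Set.mem_Ioi, not_exists, not_and]
    constructor
    · rintro ⟨⟨h1, h2⟩ | ⟨i', rfl⟩, h⟩
      · refine Or.inr ⟨⟨h, h1⟩, fun j' hj' hx => ?_⟩
        obtain ⟨j'', rfl⟩ := Fin.exists_succAbove_eq hj'.ne'
        exact h2 j'' hx.symm
      · exact Or.inl ⟨i', rfl⟩
    · rintro (⟨i', rfl⟩ | ⟨⟨h1, h2⟩, h⟩)
      · exact ⟨Or.inr ⟨i', rfl⟩, by omega⟩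
      · refine ⟨Or.inl ⟨h2, fun j' hx => ?_⟩, h1⟩
        rcases lt_or_gt_of_ne (Fin.succAbove_ne j j') with h' | h'
        · have := hn h'
          omega
        · exact h _ h' hx.symm
  rw [hset, Set.ncard_coe_finset, Finset.card_union_of_disjoint, Finset.card_sdiff_of_subset,
    Finset.card_image_of_injective _ hneg, Finset.card_image_of_injective _ hpos, Int.card_Ico,
    Fin.card_Ioi, Finset.card_univ, Fintype.card_fin]
  -- Keeps the subtraction in `ℕ` honest: the later holes are distinct numbers below `n j`.
  · have h1 : k - (j : ℕ) ≤ n j + 1 := by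
      have : (Finset.Ioi j).card ≤ (Finset.range (n j)).card :=
        Finset.card_le_card_of_injOn n (fun a ha => by
          simpa using hn (Finset.mem_Ioi.1 ha)) hn.injective.injOn
      rw [Fin.card_Ioi, Finset.card_range] at this
      omega
    have := j.is_lt
    omega
  · intro x hx
    simp only [Finset.mem_image, Finset.mem_Ioi] at hx
    obtain ⟨j', hj', rfl⟩ := hx
    have := hn hj'
    simp only [Finset.mem_Ico]
    omega
  · rw [Finset.disjoint_left]
    intro x hx hx'
    simp only [Finset.mem_image, Finset.mem_univ, true_and, Finset.mem_sdiff,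
      Finset.mem_Ico] at hx hx'
    obtain ⟨i', rfl⟩ := hx
    omega

theorem ncard_frobeniusSet_gt {k : ℕ} {m n : Fin (k + 1) → ℕ} (hm : StrictAnti m)
    (i j : Fin (k + 1)) :
    {s ∈ ((frobeniusSet (m ∘ i.succAbove) (n ∘ j.succAbove)).erase (-(n j : ℤ) - 1)).1 |
      (m i : ℤ) < s}.ncard = i := by
  classical
  have hpos : Function.Injective fun i' : Fin (k + 1) => (m i' : ℤ) :=
    fun a b h => hm.injective (by simpa using h)
  have hset : {s ∈ ((frobeniusSet (m ∘ i.succAbove) (n ∘ j.succAbove)).erase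
      (-(n j : ℤ) - 1)).1 | (m i : ℤ) < s} =
      ((Finset.Iio i).image fun i' => (m i' : ℤ) : Finset ℤ) := by
    ext x
    simp only [AdmissibleSet.erase, Set.mem_ofPred_eq, Set.mem_sdiff, mem_frobeniusSet,
      Set.mem_singleton_iff, Finset.coe_image, Finset.coe_Iio, Set.mem_image, Set.mem_Iio,
      Function.comp_apply]
    constructor
    · rintro ⟨⟨⟨h1, -⟩ | ⟨i', rfl⟩, -⟩, h⟩
      · omega
      · exact ⟨_, hm.lt_iff_gt.1 (by exact_mod_cast h), rfl⟩
    · rintro ⟨i', hi', rfl⟩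
      obtain ⟨i'', rfl⟩ := Fin.exists_succAbove_eq hi'.ne
      exact ⟨⟨Or.inr ⟨i'', rfl⟩, by omega⟩, by exact_mod_cast hm hi'⟩
  rw [hset, Set.ncard_coe_finset, Finset.card_image_of_injective _ hpos, Fin.card_Iio]

theorem extend_psiPair_frobeniusSet {k : ℕ} {m n : Fin (k + 1) → ℕ} (hm : StrictAnti m)
    (hn : StrictAnti n) (v : CompletedFock) (i j : Fin (k + 1)) :
    extend (psiPair (m i) (n j)) v (frobeniusSet m n) =
      (-1) ^ (n j + (i + j : ℕ)) * v (frobeniusSet (m ∘ i.succAbove) (n ∘ j.succAbove)) := by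
  rw [extend_psiPair v (natCast_mem_frobeniusSet.2 ⟨i, rfl⟩)
    (fun h => neg_mem_frobeniusSet.1 h j rfl) (insert_erase_frobeniusSet hm hn i j),
    ncard_frobeniusSet_ge hm hn, ncard_frobeniusSet_gt hm]
  congr 1
  rw [show n j + 1 + (j : ℕ) + 1 + i = n j + (i + j) + 2 by ring, pow_add _ _ 2]
  norm_num

theorem quadOp_frobeniusSet {k : ℕ} {m n : Fin (k + 1) → ℕ} (hm : StrictAnti m)
    (hn : StrictAnti n) (c : ℕ → ℕ → ℂ) (v : CompletedFock) :
    quadOp c v (frobeniusSet m n) = ∑ i, ∑ j, c (m i) (n j) * ((-1) ^ (n j + (i + j : ℕ)) *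
      v (frobeniusSet (m ∘ i.succAbove) (n ∘ j.succAbove))) := by
  classical
  rw [quadOp, finsum_eq_sum_of_support_subset (s := (Finset.univ ×ˢ Finset.univ).image
    fun p : Fin (k + 1) × Fin (k + 1) => (m p.1, n p.2))]
  · rw [Finset.sum_image, Finset.sum_product]
    · simp only [extend_psiPair_frobeniusSet hm hn]
    · rintro ⟨a, b⟩ - ⟨a', b'⟩ - h
      simp only [Prod.mk.injEq] at h
      rw [hm.injective h.1, hn.injective h.2]
  · rintro ⟨a, b⟩ h
    obtain ⟨h1, h2, -⟩ := extend_psiPair_ne_zero _ _ _ _ (right_ne_zero_of_mul h)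
    obtain ⟨i, rfl⟩ := natCast_mem_frobeniusSet.1 h1
    rw [neg_mem_frobeniusSet] at h2
    push Not at h2
    obtain ⟨j, rfl⟩ := h2
    simp

theorem quadOp_frobeniusSet_fin_zero (m n : Fin 0 → ℕ) (c : ℕ → ℕ → ℂ) (v : CompletedFock) :
    quadOp c v (frobeniusSet m n) = 0 := by
  by_contra h
  obtain ⟨p, hp⟩ := exists_ne_zero_of_finsum h
  obtain ⟨h1, -, -⟩ := extend_psiPair_ne_zero _ _ _ _ (right_ne_zero_of_mul hp)
  obtain ⟨i, -⟩ := natCast_mem_frobeniusSet.1 h1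
  exact i.elim0

theorem vac_apply_self : (vac : CompletedFock) (partitionSet ⊥) = 1 := by
  simp [vac, ket]

theorem vac_apply_of_ne {A : AdmissibleSet} (h : A ≠ partitionSet ⊥) :
    (vac : CompletedFock) A = 0 := by
  simp [vac, ket, h.symm]

/-- Induction on the power. In the double sum over particle `i` and hole `j`, the inner sum for each
fixed `i` is the Laplace expansion along row `i`. Each of the `k + 1` rows thus yields the whole
determinant, which turns `k!` into `(k + 1)!`. -/
theorem quadOp_iterate_vac_frobeniusSet (c : ℕ → ℕ → ℂ) (r : ℕ) {k : ℕ} {m n : Fin k → ℕ}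
    (hm : StrictAnti m) (hn : StrictAnti n) :
    ((quadOp c)^[r] (vac : CompletedFock)) (frobeniusSet m n) =
      if r = k then (k.factorial : ℂ) * ((-1) ^ (∑ i, n i) *
        (Matrix.of fun i j => c (m i) (n j)).det) else 0 := by
  induction r generalizing k with
  | zero =>
    rw [Function.iterate_zero_apply]
    cases k with
    | zero => simp [frobeniusSet_fin_zero, vac_apply_self]
    | succ k =>
      rw [if_neg (by omega), vac_apply_of_ne]
      intro h
      have h1 : (m 0 : ℤ) ∈ (partitionSet ⊥).1 := h ▸ natCast_mem_frobeniusSet.2 ⟨0, rfl⟩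
      rw [← frobeniusSet_fin_zero Fin.elim0 Fin.elim0, natCast_mem_frobeniusSet] at h1
      exact h1.elim fun i _ => i.elim0
  | succ r ih =>
    rw [Function.iterate_succ_apply']
    cases k with
    | zero => rw [quadOp_frobeniusSet_fin_zero, if_neg (by omega)]
    | succ k =>
      rw [quadOp_frobeniusSet hm hn]
      have h1 : ∀ i j : Fin (k + 1), ((quadOp c)^[r] (vac : CompletedFock))
          (frobeniusSet (m ∘ i.succAbove) (n ∘ j.succAbove)) = _ := fun i j =>
        ih (hm.comp_strictMono (Fin.strictMono_succAbove i))
          (hn.comp_strictMono (Fin.strictMono_succAbove j))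
      simp only [h1, add_left_inj]
      split_ifs with h
      · have h2 : ∀ i : Fin (k + 1), ∑ j, c (m i) (n j) * ((-1) ^ (n j + (i + j : ℕ)) *
            ((k.factorial : ℂ) * ((-1) ^ (∑ a, (n ∘ j.succAbove) a) * (Matrix.of fun a b =>
              c ((m ∘ i.succAbove) a) ((n ∘ j.succAbove) b)).det))) =
            k.factorial * ((-1) ^ (∑ a, n a) * (Matrix.of fun a b => c (m a) (n b)).det) := by
          intro i
          rw [Matrix.det_succ_row _ i, Finset.mul_sum, Finset.mul_sum]
          refine Finset.sum_congr rfl fun j _ => ?_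
          rw [Fin.sum_univ_succAbove n j, pow_add, pow_add]
          simp only [Matrix.of_apply, Function.comp_apply]
          have : (Matrix.of fun a b => c (m a) (n b)).submatrix i.succAbove j.succAbove =
            Matrix.of fun a b => c (m (i.succAbove a)) (n (j.succAbove b)) := rfl
          rw [this]
          ring
        rw [Finset.sum_congr rfl fun i _ => h2 i, Finset.sum_const, Finset.card_univ,
          Fintype.card_fin, nsmul_eq_mul, Nat.factorial_succ]
        push_cast
        ring
      · simp

/-- Wick's theorem: the coefficients of `exp (∑ c_{mn} ψ_{m+1/2} ψ*_{-n-1/2}) |0⟩` are minors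
of `c`. -/
theorem expOp_quadOp_vac_frobeniusSet (c : ℕ → ℕ → ℂ) {k : ℕ} {m n : Fin k → ℕ}
    (hm : StrictAnti m) (hn : StrictAnti n) :
    expOp (quadOp c) (vac : CompletedFock) (frobeniusSet m n) =
      (-1) ^ (∑ i, n i) * (Matrix.of fun i j => c (m i) (n j)).det := by
  rw [expOp, finsum_eq_single _ k]
  · rw [quadOp_iterate_vac_frobeniusSet c k hm hn, if_pos rfl,
      inv_mul_cancel_left₀ (Nat.cast_ne_zero.2 k.factorial_ne_zero)]
  · intro r hr
    rw [quadOp_iterate_vac_frobeniusSet c r hm hn, if_neg hr, mul_zero]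

theorem vac_mem_chargeZero : (vac : CompletedFock) ∈ chargeZero := by
  intro A hA
  apply vac_apply_of_ne
  rintro rfl
  rw [← frobeniusSet_fin_zero Fin.elim0 Fin.elim0, charge_frobeniusSet] at hA
  · exact hA rfl
  · exact fun i => i.elim0
  · exact fun i => i.elim0

/-! ### Young diagrams and their Frobenius coordinates -/

theorem rowLen_eq_zero {μ : YoungDiagram} {i : ℕ} (hi : μ.colLen 0 ≤ i) : μ.rowLen i = 0 := by
  by_contra h
  exact absurd (YoungDiagram.mem_iff_lt_colLen.1 (YoungDiagram.mem_iff_lt_rowLen.2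
    (Nat.pos_of_ne_zero h))) (not_lt.2 hi)

theorem colLen_zero_le {μ : YoungDiagram} {i : ℕ} (hi : μ.rowLen i = 0) : μ.colLen 0 ≤ i := by
  by_contra! h
  have := YoungDiagram.mem_iff_lt_rowLen.1 (YoungDiagram.mem_iff_lt_colLen.2 h)
  omega

/-- The Young diagram with given row lengths. -/
def ofRowLenFun (r : ℕ → ℕ) (hr : Antitone r) (N : ℕ) : YoungDiagram where
  cells := (Finset.range N).biUnion fun i => {i} ×ˢ Finset.range (r i)
  isLowerSet := by
    rintro ⟨i, j⟩ ⟨i', j'⟩ ⟨h1, h2⟩ h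
    simp only [Finset.coe_biUnion, Finset.coe_range, Set.mem_Iio, Finset.coe_product,
      Finset.coe_singleton, Set.mem_iUnion, Set.mem_prod, Set.mem_singleton_iff,
      exists_prop] at h ⊢
    obtain ⟨a, ha, rfl, hj⟩ := h
    simp only at h1 h2
    have := hr h1
    exact ⟨i', by omega, rfl, by omega⟩

theorem rowLen_ofRowLenFun {r : ℕ → ℕ} (hr : Antitone r) {N : ℕ} (hN : ∀ i, N ≤ i → r i = 0)
    (i : ℕ) : (ofRowLenFun r hr N).rowLen i = r i := by
  have h : ∀ j, j < (ofRowLenFun r hr N).rowLen i ↔ j < r i := fun j => by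
    rw [← YoungDiagram.mem_iff_lt_rowLen, ← YoungDiagram.mem_cells]
    simp only [ofRowLenFun, Finset.mem_biUnion, Finset.mem_range, Finset.mem_product,
      Finset.mem_singleton]
    constructor
    · rintro ⟨a, -, rfl, h⟩
      exact h
    · intro h
      refine ⟨i, ?_, rfl, h⟩
      by_contra! h'
      have := hN i h'
      omega
  exact le_antisymm (le_of_not_gt fun h' => lt_irrefl _ ((h _).1 h'))
    (le_of_not_gt fun h' => lt_irrefl _ ((h _).2 h'))

/-- A diagram is a lower set, so its diagonal cells form an initial segment, and their number is the
first diagonal index outside. -/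
theorem diag_mem_iff {μ : YoungDiagram} {i : ℕ} : (i, i) ∈ μ ↔ i < diagLen μ := by
  classical
  have hex : ∃ i, (i, i) ∉ μ := by
    obtain ⟨j, hj⟩ := μ.exists_notMem_row 0
    exact ⟨j, fun h => hj (μ.up_left_mem (Nat.zero_le _) le_rfl h)⟩
  have key : ∀ i, (i, i) ∈ μ ↔ i < Nat.find hex := fun i => by
    constructor
    · intro h
      by_contra! h'
      exact Nat.find_spec hex (μ.up_left_mem h' h' h)
    · intro h
      simpa using Nat.find_min hex h
  have hcells : (μ.cells.filter fun c => c.1 = c.2) =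
      (Finset.range (Nat.find hex)).image fun i => (i, i) := by
    ext ⟨a, b⟩
    simp only [Finset.mem_filter, YoungDiagram.mem_cells, Finset.mem_image, Finset.mem_range,
      Prod.mk.injEq, ← key]
    constructor
    · rintro ⟨h, rfl⟩
      exact ⟨a, h, rfl, rfl⟩
    · rintro ⟨a, h, rfl, rfl⟩
      exact ⟨h, rfl⟩
  rw [key, diagLen, hcells, Finset.card_image_of_injective _ fun a b h => (Prod.mk.inj h).1,
    Finset.card_range]

theorem lt_rowLen {μ : YoungDiagram} {i : ℕ} (hi : i < diagLen μ) : i < μ.rowLen i :=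
  YoungDiagram.mem_iff_lt_rowLen.1 (diag_mem_iff.2 hi)

theorem lt_colLen {μ : YoungDiagram} {i : ℕ} (hi : i < diagLen μ) : i < μ.colLen i :=
  YoungDiagram.mem_iff_lt_colLen.1 (diag_mem_iff.2 hi)

theorem rowLen_le {μ : YoungDiagram} {i : ℕ} (hi : diagLen μ ≤ i) : μ.rowLen i ≤ i := by
  by_contra! h
  exact absurd (diag_mem_iff.1 (YoungDiagram.mem_iff_lt_rowLen.2 h)) (not_lt.2 hi)

theorem diagLen_le (μ : YoungDiagram) : diagLen μ ≤ μ.colLen 0 := by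
  by_contra! h
  have := lt_rowLen h
  have := rowLen_eq_zero (le_refl (μ.colLen 0))
  omega

theorem frobM_strictAnti (μ : YoungDiagram) : StrictAnti (frobM μ) := by
  intro i j hij
  have := lt_rowLen j.2
  have := μ.rowLen_anti i j hij.le
  have : (i : ℕ) < j := hij
  simp only [frobM]
  omega

theorem frobN_strictAnti (μ : YoungDiagram) : StrictAnti (frobN μ) := by
  intro i j hij
  have := lt_colLen j.2
  have := μ.colLen_anti i j hij.le
  have : (i : ℕ) < j := hij
  simp only [frobN]
  omega

/-- Whether the cell `(j, i)` lies in `μ` can be read off from row `j` or from column `i`. If it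
does, `μ.rowLen j + μ.colLen i ≥ i + j + 2`; if not, the sum is at most `i + j`. Equality here would
make it `i + j + 1`. -/
theorem frobN_ne (μ : YoungDiagram) {i j : ℕ} (hi : i < diagLen μ) (hj : diagLen μ ≤ j) :
    μ.colLen i - (i + 1) ≠ j - μ.rowLen j := by
  have h1 := lt_colLen hi
  have h2 := rowLen_le hj
  have h3 : i < μ.rowLen j ↔ j < μ.colLen i := by
    rw [← YoungDiagram.mem_iff_lt_rowLen, YoungDiagram.mem_iff_lt_colLen]
  omega

/-- The permutation of `0, …, n - 1` given by `i ↦ n_i` for `i < k` and by `i ↦ i - μ_i` for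
`i ≥ k`, where `k` is the length of the diagonal. -/
def frobeniusPermFun (μ : YoungDiagram) (i : ℕ) : ℕ :=
  if i < diagLen μ then μ.colLen i - (i + 1) else i - μ.rowLen i

theorem frobeniusPermFun_anti (μ : YoungDiagram) {i j : ℕ} (hij : i < j) (hj : j < diagLen μ) :
    frobeniusPermFun μ j < frobeniusPermFun μ i := by
  rw [frobeniusPermFun, frobeniusPermFun, if_pos hj, if_pos (hij.trans hj)]
  exact frobN_strictAnti μ (show (⟨i, hij.trans hj⟩ : Fin _) < ⟨j, hj⟩ from hij)

theorem frobeniusPermFun_mono (μ : YoungDiagram) {i j : ℕ} (hi : diagLen μ ≤ i) (hij : i < j) :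
    frobeniusPermFun μ i < frobeniusPermFun μ j := by
  rw [frobeniusPermFun, frobeniusPermFun, if_neg (by omega), if_neg (by omega)]
  have := rowLen_le hi
  have := μ.rowLen_anti i j hij.le
  omega

theorem frobeniusPermFun_injective (μ : YoungDiagram) :
    Function.Injective (frobeniusPermFun μ) := by
  have key : ∀ i j, i < j → frobeniusPermFun μ i ≠ frobeniusPermFun μ j := fun i j hij => by
    rcases lt_or_ge j (diagLen μ) with hj | hj
    · exact (frobeniusPermFun_anti μ hij hj).ne'
    · rcases lt_or_ge i (diagLen μ) with hi | hi
      · rw [frobeniusPermFun, frobeniusPermFun, if_pos hi, if_neg (not_lt.2 hj)]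
        exact frobN_ne μ hi hj
      · exact (frobeniusPermFun_mono μ hi hij).ne
  intro i j h
  rcases lt_trichotomy i j with h' | h' | h'
  · exact absurd h (key _ _ h')
  · exact h'
  · exact absurd h.symm (key _ _ h')

theorem frobeniusPermFun_lt (μ : YoungDiagram) {n i : ℕ} (hn : μ.colLen 0 ≤ n) (hi : i < n) :
    frobeniusPermFun μ i < n := by
  rw [frobeniusPermFun]
  split_ifs with h
  · have := lt_colLen h
    have := μ.colLen_anti 0 i (Nat.zero_le _)
    omega
  · omega

/-- `frobeniusPermFun` as a permutation of `Fin n`. -/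
def frobeniusPerm (μ : YoungDiagram) {n : ℕ} (hn : μ.colLen 0 ≤ n) : Equiv.Perm (Fin n) :=
  Equiv.ofBijective (fun i => ⟨frobeniusPermFun μ i, frobeniusPermFun_lt μ hn i.2⟩)
    (Finite.injective_iff_bijective.1 fun _ _ h =>
      Fin.ext (frobeniusPermFun_injective μ (Fin.ext_iff.1 h)))

theorem coe_frobeniusPerm (μ : YoungDiagram) {n : ℕ} (hn : μ.colLen 0 ≤ n) (i : Fin n) :
    (frobeniusPerm μ hn i : ℕ) = frobeniusPermFun μ i := rfl

/-- Induction on the length of the decreasing part. Its last value `σ p` is smaller than the earlier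
ones, so the cycle on `0, …, σ p` sends it to `0`, fixes the earlier values and preserves the order
of the later ones. The increasing part thus grows by one, at the cost of the sign `(-1) ^ σ p`. -/
theorem sign_eq_of_anti_mono {n : ℕ} (k : ℕ) (hk : k ≤ n) (σ : Equiv.Perm (Fin n))
    (hanti : ∀ i j : Fin n, i < j → (j : ℕ) < k → σ j < σ i)
    (hmono : ∀ i j : Fin n, k ≤ (i : ℕ) → i < j → σ i < σ j) :
    Equiv.Perm.sign σ = (-1) ^ (∑ i : Fin k, (σ (Fin.castLE hk i) : ℕ)) := by
  induction k generalizing σ with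
  | zero =>
    have h : StrictMono σ := fun i j hij => hmono i j (Nat.zero_le _) hij
    have h1 : σ = 1 := by
      ext i
      have := congrFun ((StrictMono.range_inj (f := σ) (g := id) h strictMono_id).1
        (by simp [σ.surjective.range_eq])) i
      rw [this]
      rfl
    simp [h1]
  | succ k ih =>
    have : NeZero n := ⟨by omega⟩
    let p : Fin n := ⟨k, hk⟩
    set τ := (σ p).cycleRange * σ with hτ
    have hτ1 : ∀ i : Fin n, (i : ℕ) < k → τ i = σ i := fun i hi =>
      Fin.cycleRange_of_gt (hanti i p hi (Nat.lt_succ_self k))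
    have hτp : τ p = 0 := Fin.cycleRange_self _
    have h := ih (by omega) τ
      (fun i j hij hj => by
        rw [hτ1 j hj, hτ1 i (lt_trans hij hj)]
        exact hanti i j hij (by omega))
      (fun i j hi hij => by
        have hij' : (i : ℕ) < j := hij
        have hpj : p < j := show k < (j : ℕ) by omega
        rcases eq_or_lt_of_le hi with hi' | hi'
        · have : i = p := Fin.ext hi'.symm
          rw [this, hτp]
          refine Fin.pos_iff_ne_zero.2 fun h0 => ?_
          exact hpj.ne (τ.injective (hτp.trans h0.symm))
        · have hne : ∀ a : Fin n, k < (a : ℕ) → σ a ≠ σ p := fun a ha h => by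
            have := congrArg Fin.val (σ.injective h)
            simp only [p] at this
            omega
          have h1 := hmono i j hi' hij
          simp only [hτ, Equiv.Perm.mul_apply]
          rw [Fin.lt_def]
          rcases lt_or_gt_of_ne (hne i hi') with ha | ha <;>
          rcases lt_or_gt_of_ne (hne j hpj) with hb | hb
          · rw [Fin.coe_cycleRange_of_lt ha, Fin.coe_cycleRange_of_lt hb]
            exact Nat.succ_lt_succ h1
          · rw [Fin.coe_cycleRange_of_lt ha, Fin.cycleRange_of_gt hb]
            have : (σ i : ℕ) < σ p := ha
            have : (σ p : ℕ) < σ j := hb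
            omega
          · exact absurd (h1.trans hb) (not_lt.2 ha.le)
          · rw [Fin.cycleRange_of_gt ha, Fin.cycleRange_of_gt hb]
            exact h1)
    have h2 : Equiv.Perm.sign σ = (-1) ^ (σ p : ℕ) * Equiv.Perm.sign τ := by
      rw [hτ, Equiv.Perm.sign_mul, Fin.sign_cycleRange, ← mul_assoc, ← pow_add, ← two_mul,
        pow_mul]
      simp
    rw [h2, h, Fin.sum_univ_castSucc, pow_add, mul_comm]
    congr 2
    refine Finset.sum_congr rfl fun i _ => ?_
    rw [hτ1 _ (by simp)]
    rfl

theorem sign_frobeniusPerm (μ : YoungDiagram) {n : ℕ} (hn : μ.colLen 0 ≤ n) :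
    Equiv.Perm.sign (frobeniusPerm μ hn) = (-1) ^ (∑ i, frobN μ i) := by
  rw [sign_eq_of_anti_mono (diagLen μ) ((diagLen_le μ).trans hn) _
    (fun _ _ hij hj => frobeniusPermFun_anti μ hij hj)
    (fun _ _ hi hij => frobeniusPermFun_mono μ hi hij)]
  congr 1
  refine Finset.sum_congr rfl fun i _ => ?_
  rw [coe_frobeniusPerm, frobeniusPermFun, Fin.val_castLE, if_pos i.2, frobN]

/-- Rows below the diagonal cancel against the vacuum positions that are not holes; `frobeniusPerm`
matches them up. The choices `F x = x` and `F x = x * (x + 1)` give the size of `μ` and `κ_μ`. -/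
theorem sum_rowLen_eq {M : Type*} [AddCommGroup M] (F : ℤ → M) (μ : YoungDiagram) {n : ℕ}
    (hn : μ.colLen 0 ≤ n) :
    ∑ i ∈ Finset.range n, F ((μ.rowLen i : ℤ) - i - 1) - ∑ i ∈ Finset.range n, F (-(i : ℤ) - 1) =
      ∑ i, (F (frobM μ i) - F (-(frobN μ i : ℤ) - 1)) := by
  have hk := (diagLen_le μ).trans hn
  have h1 : ∑ i ∈ Finset.range n, F (-(i : ℤ) - 1) =
      ∑ i ∈ Finset.range n, F (-(frobeniusPermFun μ i : ℤ) - 1) := by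
    rw [← Fin.sum_univ_eq_sum_range (fun i : ℕ => F (-(i : ℤ) - 1)),
      ← Fin.sum_univ_eq_sum_range (fun i : ℕ => F (-(frobeniusPermFun μ i : ℤ) - 1)),
      ← Equiv.sum_comp (frobeniusPerm μ hn)]
    rfl
  have h2 : ∑ i, (F (frobM μ i) - F (-(frobN μ i : ℤ) - 1)) =
      ∑ i ∈ Finset.range (diagLen μ), (F ((μ.rowLen i : ℤ) - i - 1) -
        F (-(frobeniusPermFun μ i : ℤ) - 1)) := by
    rw [← Fin.sum_univ_eq_sum_range (fun i : ℕ => F ((μ.rowLen i : ℤ) - i - 1) -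
        F (-(frobeniusPermFun μ i : ℤ) - 1))]
    refine Finset.sum_congr rfl fun i _ => ?_
    have := lt_rowLen i.2
    rw [frobM, frobN, frobeniusPermFun, if_pos i.2]
    congr 2
    omega
  rw [h1, h2, ← Finset.sum_sub_distrib, ← Finset.sum_range_add_sum_Ico _ hk, add_eq_left]
  refine Finset.sum_eq_zero fun i hi => ?_
  have hi' := (Finset.mem_Ico.1 hi).1
  have := rowLen_le hi'
  rw [frobeniusPermFun, if_neg (by omega), sub_eq_zero]
  congr 1
  omega

theorem card_eq_sum_rowLen (μ : YoungDiagram) {n : ℕ} (hn : μ.colLen 0 ≤ n) :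
    μ.card = ∑ i ∈ Finset.range n, μ.rowLen i := by
  have h : μ.cells = (Finset.range n).biUnion fun i => μ.row i := by
    ext ⟨i, j⟩
    simp only [Finset.mem_biUnion, Finset.mem_range, YoungDiagram.mem_row_iff,
      YoungDiagram.mem_cells]
    constructor
    · intro h
      refine ⟨i, lt_of_lt_of_le ?_ hn, h, rfl⟩
      exact YoungDiagram.mem_iff_lt_colLen.1 (μ.up_left_mem le_rfl (Nat.zero_le _) h)
    · rintro ⟨a, -, h, -⟩
      exact h
  rw [YoungDiagram.card, h, Finset.card_biUnion]
  · exact Finset.sum_congr rfl fun i _ => (μ.rowLen_eq_card).symm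
  · intro i _ j _ hij
    refine Finset.disjoint_left.2 fun c hc hc' => ?_
    exact hij ((YoungDiagram.mem_row_iff.1 hc).2.symm.trans (YoungDiagram.mem_row_iff.1 hc').2)

theorem card_eq_sum_frob (μ : YoungDiagram) :
    μ.card = ∑ i, (frobM μ i + frobN μ i + 1) := by
  have h := sum_rowLen_eq (fun x => x) μ le_rfl
  rw [← Finset.sum_sub_distrib] at h
  rw [card_eq_sum_rowLen μ le_rfl]
  zify
  rw [show ∑ i ∈ Finset.range (μ.colLen 0), (μ.rowLen i : ℤ) =
    ∑ i ∈ Finset.range (μ.colLen 0), (((μ.rowLen i : ℤ) - i - 1) - (-(i : ℤ) - 1)) from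
    Finset.sum_congr rfl fun i _ => by ring, h]
  exact Finset.sum_congr rfl fun i _ => by ring

theorem kappa_eq_sum_frob (μ : YoungDiagram) :
    kappa μ = ∑ i, ((frobM μ i : ℤ) - frobN μ i) * (frobM μ i + frobN μ i + 1) := by
  have h := sum_rowLen_eq (fun x => x * (x + 1)) μ le_rfl
  rw [← Finset.sum_sub_distrib] at h
  rw [kappa, show ∑ i ∈ Finset.range (μ.colLen 0),
    (μ.rowLen i : ℤ) * ((μ.rowLen i : ℤ) - 2 * ((i : ℤ) + 1) + 1) =
    ∑ i ∈ Finset.range (μ.colLen 0), (((μ.rowLen i : ℤ) - i - 1) * ((μ.rowLen i : ℤ) - i - 1 + 1) -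
      (-(i : ℤ) - 1) * (-(i : ℤ) - 1 + 1)) from
    Finset.sum_congr rfl fun i _ => by ring, h]
  exact Finset.sum_congr rfl fun i _ => by ring

theorem partitionSet_eq_frobeniusSet (μ : YoungDiagram) :
    partitionSet μ = frobeniusSet (frobM μ) (frobN μ) := by
  apply Subtype.ext
  ext x
  rw [mem_frobeniusSet]
  simp only [partitionSet, Set.mem_range]
  constructor
  · rintro ⟨i, rfl⟩
    rcases lt_or_ge i (diagLen μ) with hi | hi
    · have := lt_rowLen hi
      exact Or.inr ⟨⟨i, hi⟩, by simp only [frobM]; omega⟩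
    · have := rowLen_le hi
      refine Or.inl ⟨by omega, fun j hj => frobN_ne μ j.2 hi ?_⟩
      simp only [frobN] at hj
      omega
  · rintro (⟨h1, h2⟩ | ⟨i, rfl⟩)
    -- The size exceeds `-x - 1`, so that `frobeniusPerm` attains this value. An index on the
    -- diagonal would make `x` a hole, so the index is a row below the diagonal.
    · have hn : μ.colLen 0 ≤ max (μ.colLen 0) ((-x).toNat) := le_max_left _ _
      obtain ⟨i, hi⟩ := (frobeniusPerm μ hn).surjective
        ⟨(-x - 1).toNat, lt_of_lt_of_le (by omega) (le_max_right _ _)⟩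
      have hi' := congrArg Fin.val hi
      rw [coe_frobeniusPerm] at hi'
      simp only at hi'
      rcases lt_or_ge (i : ℕ) (diagLen μ) with hik | hik
      · refine absurd ?_ (h2 ⟨i, hik⟩)
        rw [frobeniusPermFun, if_pos hik] at hi'
        simp only [frobN]
        omega
      · refine ⟨i, ?_⟩
        rw [frobeniusPermFun, if_neg (by omega)] at hi'
        have := rowLen_le hik
        omega
    · have := lt_rowLen i.2
      exact ⟨i, by simp only [frobM]; omega⟩

theorem charge_partitionSet (μ : YoungDiagram) : (partitionSet μ).charge = 0 := by
  rw [partitionSet_eq_frobeniusSet]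
  exact charge_frobeniusSet (frobM_strictAnti μ).injective (frobN_strictAnti μ).injective

/-- Cut at `-N`, below all holes. Charge 0 means that exactly `N` elements of `A` are at least `-N`;
in decreasing order they are the numbers `μ_i - (i + 1)` for `i < N`, and the remaining rows are
empty. -/
theorem exists_partitionSet_eq {A : AdmissibleSet} (hA : A.charge = 0) :
    ∃ μ, partitionSet μ = A := by
  classical
  obtain ⟨N, hN⟩ : ∃ N : ℕ, ∀ x ∈ Set.Iio 0 \ A.1, -(N : ℤ) ≤ x := by
    obtain ⟨b, hb⟩ := A.2.1.bddBelow
    exact ⟨(-b).toNat, fun x hx => by have := hb hx; omega⟩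
  let S : Finset ℤ := A.2.2.toFinset ∪ (Finset.Ico (-(N : ℤ)) 0 \ A.2.1.toFinset)
  have hS : ∀ x, x ∈ S ↔ x ∈ A.1 ∧ -(N : ℤ) ≤ x := fun x => by
    simp only [S, Finset.mem_union, Set.Finite.mem_toFinset, Finset.mem_sdiff, Finset.mem_Ico,
      Set.mem_sdiff, Set.mem_Iio]
    constructor
    · rintro (⟨h1, h2⟩ | ⟨⟨h1, h2⟩, h3⟩)
      · exact ⟨h1, by omega⟩
      · exact ⟨by tauto, h1⟩
    · rintro ⟨h1, h2⟩
      by_cases h : x < 0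
      · exact Or.inr ⟨⟨h2, h⟩, by tauto⟩
      · exact Or.inl ⟨h1, h⟩
  have hcard : S.card = N := by
    have h1 : A.2.1.toFinset ⊆ Finset.Ico (-(N : ℤ)) 0 := fun x hx => by
      rw [Set.Finite.mem_toFinset] at hx
      exact Finset.mem_Ico.2 ⟨hN x hx, hx.1⟩
    have h2 := Finset.card_le_card h1
    rw [Finset.card_union_of_disjoint, Finset.card_sdiff_of_subset h1, Int.card_Ico]
    · rw [AdmissibleSet.charge, Set.ncard_eq_toFinset_card _ A.2.1,
        Set.ncard_eq_toFinset_card _ A.2.2] at hA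
      rw [Int.card_Ico] at h2
      omega
    · rw [Finset.disjoint_left]
      intro x hx hx'
      rw [Set.Finite.mem_toFinset] at hx
      exact hx.2 (Finset.mem_Ico.1 (Finset.mem_sdiff.1 hx').1).2
  let s := S.orderEmbOfFin hcard
  -- Makes the row lengths below nonnegative, so that `toNat` loses nothing.
  have hs : ∀ j (hj : j < N), -(N : ℤ) + j ≤ s ⟨j, hj⟩ := fun j => by
    induction j with
    | zero => intro hj; simpa using ((hS _).1 (S.orderEmbOfFin_mem hcard ⟨0, hj⟩)).2
    | succ j ih =>
      intro hj
      have h1 := ih (by omega)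
      have h2 : s ⟨j, by omega⟩ < s ⟨j + 1, hj⟩ := s.strictMono (Nat.lt_succ_self j)
      push_cast
      omega
  let r : ℕ → ℕ := fun i => if h : i < N then (s ⟨N - 1 - i, by omega⟩ + i + 1).toNat else 0
  have hr1 : ∀ i (h : i < N), (r i : ℤ) - (i + 1) = s ⟨N - 1 - i, by omega⟩ := fun i h => by
    have := hs (N - 1 - i) (by omega)
    simp only [r, dif_pos h]
    omega
  have hr0 : ∀ i, N ≤ i → r i = 0 := fun i h => dif_neg (by omega)
  have hr : Antitone r := antitone_nat_of_succ_le fun i => by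
    by_cases h : i + 1 < N
    · have h1 := hr1 i (by omega)
      have h2 := hr1 (i + 1) h
      have h3 : s ⟨N - 1 - (i + 1), by omega⟩ < s ⟨N - 1 - i, by omega⟩ :=
        s.strictMono (show N - 1 - (i + 1) < N - 1 - i by omega)
      push_cast at h2
      omega
    · rw [hr0 (i + 1) (by omega)]
      exact Nat.zero_le _
  refine ⟨ofRowLenFun r hr N, Subtype.ext ?_⟩
  ext x
  simp only [partitionSet, Set.mem_range, rowLen_ofRowLenFun hr hr0]
  constructor
  · rintro ⟨i, rfl⟩
    by_cases h : i < N
    · rw [hr1 i h]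
      exact ((hS _).1 (S.orderEmbOfFin_mem hcard _)).1
    · rw [hr0 i (by omega)]
      by_contra hx
      have := hN _ ⟨show (((0 : ℕ) : ℤ) - (i + 1) : ℤ) < 0 by omega, hx⟩
      omega
  · intro hx
    by_cases h : -(N : ℤ) ≤ x
    · have : x ∈ Set.range s := by
        rw [Finset.range_orderEmbOfFin]
        exact (hS x).2 ⟨hx, h⟩
      obtain ⟨⟨j, hj⟩, rfl⟩ := this
      refine ⟨N - 1 - j, ?_⟩
      rw [hr1 _ (by omega)]
      congr 2
      omega
    · refine ⟨(-x - 1).toNat, ?_⟩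
      rw [hr0 _ (by omega)]
      omega

/-! ### The branching rule for semistandard tableaux with bounded entries -/

/-- Semistandard tableaux with entries less than `n`. -/
abbrev BoundedTableau (n : ℕ) (μ : YoungDiagram) :=
  {T : SemistandardYoungTableau μ // ∀ i j, (i, j) ∈ μ → T i j < n}

instance (n : ℕ) (μ : YoungDiagram) : Finite (BoundedTableau n μ) := by
  refine Finite.of_injective
    (fun T (c : {c // c ∈ μ.cells}) => (⟨T.1 c.1.1 c.1.2, T.2 _ _ c.2⟩ : Fin n)) fun T T' h => ?_
  apply Subtype.ext
  ext i j
  by_cases hij : (i, j) ∈ μ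
  · have := congrFun h ⟨(i, j), hij⟩
    simpa using this
  · rw [T.1.zeros hij, T'.1.zeros hij]

instance (n : ℕ) (μ : YoungDiagram) : Fintype (BoundedTableau n μ) := Fintype.ofFinite _

/-- The Schur polynomial in the first `n` variables of the sequence `x`. -/
def boundedSchur (n : ℕ) (μ : YoungDiagram) (x : ℕ → ℂ) : ℂ :=
  ∑ T : BoundedTableau n μ, tableauWeight x T.1

theorem boundedSchur_bot (n : ℕ) (x : ℕ → ℂ) : boundedSchur n ⊥ x = 1 := by
  have : Unique (BoundedTableau n ⊥) :=
    { default := ⟨default, fun i j h => absurd h (YoungDiagram.notMem_bot _)⟩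
      uniq := fun T => Subtype.ext <| by
        ext i j
        rw [T.1.zeros (YoungDiagram.notMem_bot _),
          SemistandardYoungTableau.zeros _ (YoungDiagram.notMem_bot _)] }
  rw [boundedSchur, Fintype.sum_unique, tableauWeight, YoungDiagram.cells_bot, Finset.prod_empty]

theorem le_tableau_apply {μ : YoungDiagram} (T : SemistandardYoungTableau μ) {i j : ℕ}
    (h : (i, j) ∈ μ) : i ≤ T i j := by
  induction i with
  | zero => exact Nat.zero_le _
  | succ i ih =>
    have h1 := ih (μ.up_left_mem (Nat.le_succ i) le_rfl h)
    have h2 := T.col_strict (Nat.lt_add_one i) h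
    omega

/-- The diagram of the entries of `T` which are less than `n`. -/
def belowDiagram (n : ℕ) {μ : YoungDiagram} (T : SemistandardYoungTableau μ) : YoungDiagram where
  cells := μ.cells.filter fun c => T c.1 c.2 < n
  isLowerSet := by
    rintro ⟨i, j⟩ ⟨i', j'⟩ ⟨h1, h2⟩ h
    simp only [Finset.coe_filter, Set.mem_ofPred_eq, YoungDiagram.mem_cells] at h h1 h2 ⊢
    have h3 := μ.up_left_mem h1 h2 h.1
    have h4 := μ.up_left_mem h1 le_rfl h.1
    exact ⟨h3, ((T.row_weak_of_le h2 h4).trans (T.col_weak h1 h.1)).trans_lt h.2⟩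

theorem mem_belowDiagram {n : ℕ} {μ : YoungDiagram} {T : SemistandardYoungTableau μ} {i j : ℕ} :
    (i, j) ∈ belowDiagram n T ↔ (i, j) ∈ μ ∧ T i j < n := by
  rw [← YoungDiagram.mem_cells]
  simp [belowDiagram]

/-- `μ / ν` is a horizontal strip. -/
def IsHorizontalStrip (μ ν : YoungDiagram) : Prop :=
  ∀ i, μ.rowLen (i + 1) ≤ ν.rowLen i ∧ ν.rowLen i ≤ μ.rowLen i

theorem IsHorizontalStrip.mem {μ ν : YoungDiagram} (h : IsHorizontalStrip μ ν) {i j : ℕ}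
    (hij : (i, j) ∈ ν) : (i, j) ∈ μ := by
  rw [YoungDiagram.mem_iff_lt_rowLen] at *
  exact hij.trans_le (h i).2

theorem IsHorizontalStrip.mem_of_lt {μ ν : YoungDiagram} (h : IsHorizontalStrip μ ν)
    {i i' j : ℕ} (hi : i < i') (hij : (i', j) ∈ μ) : (i, j) ∈ ν := by
  have := μ.up_left_mem (show i + 1 ≤ i' from hi) le_rfl hij
  rw [YoungDiagram.mem_iff_lt_rowLen] at *
  exact this.trans_le (h i).1

theorem rowLen_le_rowLen_of_forall {μ ν : YoungDiagram} {i i' : ℕ}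
    (h : ∀ j, (i, j) ∈ μ → (i', j) ∈ ν) : μ.rowLen i ≤ ν.rowLen i' := by
  by_contra! h'
  have := h _ (YoungDiagram.mem_iff_lt_rowLen.2 h')
  exact lt_irrefl _ (YoungDiagram.mem_iff_lt_rowLen.1 this)

theorem isHorizontalStrip_belowDiagram {n : ℕ} {μ : YoungDiagram} (T : BoundedTableau (n + 1) μ) :
    IsHorizontalStrip μ (belowDiagram n T.1) := by
  refine fun i => ⟨rowLen_le_rowLen_of_forall fun j h => ?_,
    rowLen_le_rowLen_of_forall fun j h => (mem_belowDiagram.1 h).1⟩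
  rw [mem_belowDiagram]
  have h1 := T.1.col_strict (Nat.lt_add_one i) h
  have h2 := T.2 _ _ h
  exact ⟨μ.up_left_mem (Nat.le_succ i) le_rfl h, by omega⟩

/-- Columns increase strictly, so entries below `n` occupy only the first `n` rows. -/
theorem rowLen_belowDiagram {n : ℕ} {μ : YoungDiagram} (T : SemistandardYoungTableau μ) :
    (belowDiagram n T).rowLen n = 0 := by
  by_contra h
  have := mem_belowDiagram.1 (YoungDiagram.mem_iff_lt_rowLen.2 (Nat.pos_of_ne_zero h))
  have := le_tableau_apply T this.1
  omega

/-- The restriction of a tableau to the cells with entries less than `n`. -/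
def restrictTableau {n : ℕ} {μ ν : YoungDiagram} (T : SemistandardYoungTableau μ)
    (h : belowDiagram n T = ν) : BoundedTableau n ν :=
  ⟨{ entry := fun i j => if (i, j) ∈ ν then T i j else 0
     row_weak' := fun {i j1 j2} hj hν => by
      rw [if_pos hν, if_pos (ν.up_left_mem le_rfl hj.le hν)]
      exact T.row_weak hj (mem_belowDiagram.1 (h ▸ hν)).1
     col_strict' := fun {i1 i2 j} hi hν => by
      rw [if_pos hν, if_pos (ν.up_left_mem hi.le le_rfl hν)]
      exact T.col_strict hi (mem_belowDiagram.1 (h ▸ hν)).1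
     zeros' := fun h => if_neg h },
    fun i j hν => by
      change (if (i, j) ∈ ν then T i j else 0) < n
      rw [if_pos hν]
      exact (mem_belowDiagram.1 (h ▸ hν)).2⟩

theorem restrictTableau_apply {n : ℕ} {μ ν : YoungDiagram} (T : SemistandardYoungTableau μ)
    (h : belowDiagram n T = ν) (i j : ℕ) :
    (restrictTableau T h).1 i j = if (i, j) ∈ ν then T i j else 0 := rfl

/-- The extension of a tableau by the entry `n` along a horizontal strip. -/
def extendTableau {n : ℕ} {μ ν : YoungDiagram} (h : IsHorizontalStrip μ ν)
    (T : BoundedTableau n ν) : BoundedTableau (n + 1) μ :=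
  ⟨{ entry := fun i j => if (i, j) ∈ ν then T.1 i j else if (i, j) ∈ μ then n else 0
     row_weak' := fun {i j1 j2} hj hμ => by
      by_cases h2 : (i, j2) ∈ ν
      · rw [if_pos h2, if_pos (ν.up_left_mem le_rfl hj.le h2)]
        exact T.1.row_weak hj h2
      · rw [if_neg h2, if_pos hμ]
        split_ifs with h1
        · exact (T.2 _ _ h1).le
        · exact le_rfl
        · exact Nat.zero_le _
     col_strict' := fun {i1 i2 j} hi hμ => by
      rw [if_pos (h.mem_of_lt hi hμ), if_pos hμ]
      split_ifs with h2
      · exact T.1.col_strict hi h2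
      · exact T.2 _ _ (h.mem_of_lt hi hμ)
     zeros' := fun h0 => by rw [if_neg fun h' => h0 (h.mem h'), if_neg h0] },
    fun i j hμ => by
      change (if (i, j) ∈ ν then T.1 i j else if (i, j) ∈ μ then n else 0) < n + 1
      rw [if_pos hμ]
      split_ifs with h1
      · exact (T.2 _ _ h1).trans (Nat.lt_succ_self n)
      · exact Nat.lt_succ_self n⟩

theorem extendTableau_apply {n : ℕ} {μ ν : YoungDiagram} (h : IsHorizontalStrip μ ν)
    (T : BoundedTableau n ν) (i j : ℕ) :
    (extendTableau h T).1 i j =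
      if (i, j) ∈ ν then T.1 i j else if (i, j) ∈ μ then n else 0 := rfl

theorem belowDiagram_extendTableau {n : ℕ} {μ ν : YoungDiagram} (h : IsHorizontalStrip μ ν)
    (T : BoundedTableau n ν) : belowDiagram n (extendTableau h T).1 = ν := by
  ext ⟨i, j⟩
  rw [YoungDiagram.mem_cells, YoungDiagram.mem_cells, mem_belowDiagram, extendTableau_apply]
  constructor
  · rintro ⟨h1, h2⟩
    by_contra h3
    rw [if_neg h3, if_pos h1] at h2
    exact lt_irrefl _ h2
  · intro h1
    rw [if_pos h1]
    exact ⟨h.mem h1, T.2 _ _ h1⟩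

/-- A tableau in the fiber is a tableau on `ν` with entries below `n`, and every cell of `μ / ν`
holds `n`. -/
theorem sum_tableauWeight_fiber {n : ℕ} {μ ν : YoungDiagram} (h : IsHorizontalStrip μ ν)
    (x : ℕ → ℂ) [DecidablePred fun T : BoundedTableau (n + 1) μ => belowDiagram n T.1 = ν] :
    ∑ T : BoundedTableau (n + 1) μ with belowDiagram n T.1 = ν, tableauWeight x T.1 =
      x n ^ (μ.card - ν.card) * boundedSchur n ν x := by
  have hsub : ν.cells ⊆ μ.cells := fun c hc => h.mem (i := c.1) (j := c.2) hc
  rw [boundedSchur, Finset.mul_sum]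
  refine Finset.sum_bij' (fun T hT => restrictTableau T.1 (Finset.mem_filter.1 hT).2)
    (fun T _ => extendTableau h T) (fun T hT => Finset.mem_univ _)
    (fun T _ => Finset.mem_filter.2 ⟨Finset.mem_univ _, belowDiagram_extendTableau h T⟩)
    ?_ ?_ ?_
  · intro T hT
    apply Subtype.ext
    ext i j
    have hν := (Finset.mem_filter.1 hT).2
    rw [extendTableau_apply, restrictTableau_apply]
    split_ifs with h1 h2
    · rfl
    · have h3 := T.2 _ _ h2
      have h4 : ¬ T.1 i j < n := fun h4 => h1 (hν ▸ mem_belowDiagram.2 ⟨h2, h4⟩)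
      omega
    · exact (T.1.zeros h2).symm
  · intro T _
    apply Subtype.ext
    ext i j
    rw [restrictTableau_apply, extendTableau_apply]
    split_ifs with h1
    · rfl
    · exact (T.1.zeros h1).symm
  · intro T hT
    have hν := (Finset.mem_filter.1 hT).2
    rw [tableauWeight, tableauWeight, ← Finset.prod_sdiff hsub, YoungDiagram.card,
      YoungDiagram.card, ← Finset.card_sdiff_of_subset hsub, ← Finset.prod_const]
    congr 1
    · refine Finset.prod_congr rfl fun c hc => ?_
      obtain ⟨h1, h2⟩ := Finset.mem_sdiff.1 hc
      have h3 := T.2 _ _ h1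
      have h4 : ¬ T.1 c.1 c.2 < n := fun h4 => h2 (by
        rw [YoungDiagram.mem_cells, ← hν]
        exact mem_belowDiagram.2 ⟨h1, h4⟩)
      congr 1
      omega
    · refine Finset.prod_congr rfl fun c hc => ?_
      rw [restrictTableau_apply, if_pos (show (c.1, c.2) ∈ ν from hc)]

/-- The function on `ℕ` which extends `r` by `0`. -/
def extendZero {n : ℕ} (r : Fin n → ℕ) (i : ℕ) : ℕ := if h : i < n then r ⟨i, h⟩ else 0

theorem extendZero_of_lt {n : ℕ} (r : Fin n → ℕ) (i : Fin n) : extendZero r i = r i :=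
  dif_pos i.2

theorem extendZero_of_le {n : ℕ} (r : Fin n → ℕ) {i : ℕ} (hi : n ≤ i) : extendZero r i = 0 :=
  dif_neg (not_lt.2 hi)

open Classical in
/-- The Young diagram with row lengths `r`. -/
def diagramOfRows {n : ℕ} (r : Fin n → ℕ) : YoungDiagram :=
  if h : Antitone (extendZero r) then ofRowLenFun (extendZero r) h n else ⊥

/-- The possible row lengths of the diagrams `ν` with at most `n` rows such that `μ / ν` is a
horizontal strip. -/
def interlacingRows (n : ℕ) (μ : YoungDiagram) : Finset (Fin n → ℕ) :=
  Fintype.piFinset fun i => Finset.Icc (μ.rowLen (i + 1)) (μ.rowLen i)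

theorem mem_interlacingRows {n : ℕ} {μ : YoungDiagram} {r : Fin n → ℕ} :
    r ∈ interlacingRows n μ ↔ ∀ i : Fin n, μ.rowLen (i + 1) ≤ r i ∧ r i ≤ μ.rowLen i := by
  simp [interlacingRows]

/-- Hence `diagramOfRows` never needs its default value `⊥` on interlacing rows. -/
theorem antitone_extendZero {n : ℕ} {μ : YoungDiagram} {r : Fin n → ℕ}
    (hr : r ∈ interlacingRows n μ) : Antitone (extendZero r) := by
  rw [mem_interlacingRows] at hr
  refine antitone_nat_of_succ_le fun i => ?_
  by_cases h : i + 1 < n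
  · rw [extendZero, extendZero, dif_pos h, dif_pos (by omega)]
    exact (hr ⟨i + 1, h⟩).2.trans (hr ⟨i, by omega⟩).1
  · rw [extendZero, dif_neg h]
    exact Nat.zero_le _

theorem rowLen_diagramOfRows {n : ℕ} {μ : YoungDiagram} {r : Fin n → ℕ}
    (hr : r ∈ interlacingRows n μ) (i : ℕ) : (diagramOfRows r).rowLen i = extendZero r i := by
  rw [diagramOfRows, dif_pos (antitone_extendZero hr),
    rowLen_ofRowLenFun _ fun i hi => extendZero_of_le r hi]

theorem isHorizontalStrip_diagramOfRows {n : ℕ} {μ : YoungDiagram} (hμ : μ.colLen 0 ≤ n + 1)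
    {r : Fin n → ℕ} (hr : r ∈ interlacingRows n μ) : IsHorizontalStrip μ (diagramOfRows r) := by
  intro i
  rw [rowLen_diagramOfRows hr]
  rcases lt_or_ge i n with h | h
  · exact extendZero_of_lt r ⟨i, h⟩ ▸ mem_interlacingRows.1 hr ⟨i, h⟩
  · rw [extendZero_of_le r h, rowLen_eq_zero (by omega)]
    exact ⟨le_rfl, Nat.zero_le _⟩

theorem colLen_diagramOfRows {n : ℕ} {μ : YoungDiagram} {r : Fin n → ℕ}
    (hr : r ∈ interlacingRows n μ) : (diagramOfRows r).colLen 0 ≤ n :=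
  colLen_zero_le (by rw [rowLen_diagramOfRows hr, extendZero_of_le r le_rfl])

theorem card_diagramOfRows {n : ℕ} {μ : YoungDiagram} {r : Fin n → ℕ}
    (hr : r ∈ interlacingRows n μ) : (diagramOfRows r).card = ∑ i, r i := by
  rw [card_eq_sum_rowLen _ (colLen_diagramOfRows hr), ← Fin.sum_univ_eq_sum_range]
  exact Finset.sum_congr rfl fun i _ => by rw [rowLen_diagramOfRows hr, extendZero_of_lt]

theorem card_diagramOfRows_le {n : ℕ} {μ : YoungDiagram} (hμ : μ.colLen 0 ≤ n + 1)
    {r : Fin n → ℕ} (hr : r ∈ interlacingRows n μ) : (diagramOfRows r).card ≤ μ.card :=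
  Finset.card_le_card fun c hc =>
    (isHorizontalStrip_diagramOfRows hμ hr).mem (i := c.1) (j := c.2) hc

theorem eq_of_rowLen_eq {μ ν : YoungDiagram} (h : ∀ i, μ.rowLen i = ν.rowLen i) : μ = ν := by
  ext ⟨i, j⟩
  rw [YoungDiagram.mem_cells, YoungDiagram.mem_cells, YoungDiagram.mem_iff_lt_rowLen,
    YoungDiagram.mem_iff_lt_rowLen, h]

/-- The branching rule for Schur polynomials. -/
theorem boundedSchur_succ {n : ℕ} {μ : YoungDiagram} (hμ : μ.colLen 0 ≤ n + 1) (x : ℕ → ℂ) :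
    boundedSchur (n + 1) μ x = ∑ r ∈ interlacingRows n μ,
      x n ^ (μ.card - (diagramOfRows r).card) * boundedSchur n (diagramOfRows r) x := by
  classical
  have hmaps : ∀ T ∈ (Finset.univ : Finset (BoundedTableau (n + 1) μ)),
      (fun i : Fin n => (belowDiagram n T.1).rowLen i) ∈ interlacingRows n μ := fun T _ =>
    mem_interlacingRows.2 fun i => isHorizontalStrip_belowDiagram T i
  rw [boundedSchur, ← Finset.sum_fiberwise_of_maps_to hmaps]
  refine Finset.sum_congr rfl fun r hr => ?_
  rw [← sum_tableauWeight_fiber (isHorizontalStrip_diagramOfRows hμ hr)]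
  refine Finset.sum_congr (Finset.filter_congr fun T _ => ?_) fun _ _ => rfl
  constructor
  · rintro rfl
    refine eq_of_rowLen_eq fun i => ?_
    rw [rowLen_diagramOfRows hr]
    rcases lt_or_ge i n with h | h
    · exact (extendZero_of_lt (fun i : Fin n => (belowDiagram n T.1).rowLen i) ⟨i, h⟩).symm
    · rw [extendZero_of_le _ h]
      have h1 := (belowDiagram n T.1).rowLen_anti n i h
      rw [rowLen_belowDiagram] at h1
      exact Nat.le_zero.1 h1
  · intro h
    funext i
    rw [h, rowLen_diagramOfRows hr, extendZero_of_lt]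

/-! ### The principal specialization of Schur polynomials -/

/-- Subtracting from each row its predecessor leaves `(1, 0, …, 0)` in the first column. -/
theorem det_vandermonde_succ_eq_det_sub {R : Type*} [CommRing R] {n : ℕ} (v : Fin (n + 1) → R) :
    (Matrix.vandermonde v).det =
      (Matrix.of fun i j : Fin n => v i.succ ^ (j + 1 : ℕ) - v i.castSucc ^ (j + 1 : ℕ)).det := by
  rw [Matrix.det_eq_of_forall_row_eq_smul_add_pred (A := Matrix.vandermonde v)
    (B := Matrix.of fun i j => Fin.cases (v 0 ^ (j : ℕ))
      (fun i' => v i'.succ ^ (j : ℕ) - v i'.castSucc ^ (j : ℕ)) i) (fun _ => 1)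
    (fun j => rfl) (fun i j => by simp [Matrix.vandermonde_apply]),
    Matrix.det_succ_column_zero, Fin.sum_univ_succ]
  simp only [Matrix.of_apply, Fin.cases_zero, Fin.cases_succ, Fin.val_zero, pow_zero, sub_self,
    mul_zero, zero_mul, Finset.sum_const_zero, add_zero, mul_one, one_mul]
  congr 1

/-- The factor `q ^ ρ i` goes into row `i`, raising its exponents to `j + 1`. By multilinearity the
sum over the box is taken row by row. Each entry becomes a geometric sum, whose denominator depends
only on the column and whose numerator is an entry of `det_vandermonde_succ_eq_det_sub`. -/
theorem sum_det_vandermonde {q : ℂ} (hq : ∀ j : ℕ, q ^ (j + 1) ≠ 1) {n : ℕ} (l : Fin (n + 1) → ℕ)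
    (hl : ∀ i : Fin n, l i.succ ≤ l i.castSucc) :
    ∑ ρ ∈ Fintype.piFinset fun i : Fin n => Finset.Ico (l i.succ) (l i.castSucc),
      (∏ i, q ^ ρ i) * (Matrix.vandermonde fun i => q ^ ρ i).det =
    (∏ j : Fin n, (1 - q ^ (j + 1 : ℕ))⁻¹) * (Matrix.vandermonde fun i => q ^ l i).det := by
  let g : Fin n → ℕ → Fin n → ℂ := fun _ b j => (q ^ (j + 1 : ℕ)) ^ b
  let D := (Matrix.detRowAlternating (R := ℂ) (n := Fin n)).toMultilinearMap
  have h1 : ∀ ρ : Fin n → ℕ, (∏ i, q ^ ρ i) * (Matrix.vandermonde fun i => q ^ ρ i).det =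
      D fun i => g i (ρ i) := by
    intro ρ
    rw [← Matrix.det_mul_column]
    change Matrix.det _ = Matrix.det _
    congr 1
    ext i j
    simp only [Matrix.of_apply, Matrix.vandermonde_apply, g]
    ring
  rw [Finset.sum_congr rfl fun ρ _ => h1 ρ, ← D.map_sum_finset g,
    det_vandermonde_succ_eq_det_sub, ← Matrix.det_mul_row]
  change Matrix.det _ = Matrix.det _
  congr 1
  ext i j
  rw [Finset.sum_apply, geom_sum_Ico (hq j) (hl i), Matrix.of_apply, Matrix.of_apply,
    ← pow_mul, ← pow_mul, ← pow_mul, ← pow_mul, mul_comm (l i.succ), mul_comm (l i.castSucc),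
    ← neg_div_neg_eq, neg_sub, neg_sub, div_eq_mul_inv, mul_comm]

/-- The shifted row lengths `μ_i + n - i`, where `i = 1, …, n`. -/
def shiftedRow (n : ℕ) (μ : YoungDiagram) (i : Fin n) : ℕ := μ.rowLen i + (n - 1 - i)

theorem rowLen_bot (i : ℕ) : (⊥ : YoungDiagram).rowLen i = 0 := by
  by_contra h
  exact YoungDiagram.notMem_bot _ (YoungDiagram.mem_iff_lt_rowLen.2 (Nat.pos_of_ne_zero h))

theorem shiftedRow_bot (n : ℕ) (i : Fin n) : shiftedRow n ⊥ i = n - 1 - i := by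
  rw [shiftedRow, rowLen_bot, zero_add]

theorem shiftedRow_strictAnti (n : ℕ) (μ : YoungDiagram) : StrictAnti (shiftedRow n μ) := by
  intro i j hij
  have := μ.rowLen_anti i j hij.le
  have : (i : ℕ) < j := hij
  simp only [shiftedRow]
  omega

theorem pow_injective_of_forall_ne_one {q : ℂ} (hq0 : q ≠ 0) (hq : ∀ j : ℕ, q ^ (j + 1) ≠ 1) :
    Function.Injective fun j : ℕ => q ^ j := by
  have key : ∀ a b : ℕ, a < b → q ^ a ≠ q ^ b := fun a b hab h => by
    obtain ⟨c, rfl⟩ := Nat.exists_eq_add_of_lt hab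
    rw [add_assoc, pow_add] at h
    exact hq c (mul_left_cancel₀ (pow_ne_zero a hq0) (by rw [← h, mul_one]))
  intro a b h
  rcases lt_trichotomy a b with h' | h' | h'
  · exact absurd h (key _ _ h')
  · exact h'
  · exact absurd h.symm (key _ _ h')

/-- The shift `r i + (n - 1 - i)` turns the interlacing condition into membership in the half-open
intervals between consecutive shifted rows of `μ`. -/
theorem sum_interlacingRows_det_vandermonde {q : ℂ} (hq : ∀ j : ℕ, q ^ (j + 1) ≠ 1) (n : ℕ)
    (μ : YoungDiagram) :
    (∏ i : Fin n, q ^ (n - 1 - i : ℕ)) * ∑ r ∈ interlacingRows n μ, q ^ (∑ i, r i) *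
        (Matrix.vandermonde fun i => q ^ (r i + (n - 1 - i))).det =
      (∏ j : Fin n, (1 - q ^ (j + 1 : ℕ))⁻¹) *
        (Matrix.vandermonde fun i => q ^ shiftedRow (n + 1) μ i).det := by
  rw [← sum_det_vandermonde hq _
    fun i => (shiftedRow_strictAnti (n + 1) μ).antitone i.castSucc_lt_succ.le, Finset.mul_sum]
  refine Finset.sum_nbij' (fun r i => r i + (n - 1 - i)) (fun ρ i => ρ i - (n - 1 - i))
    ?_ ?_ ?_ ?_ ?_
  · intro r hr
    rw [mem_interlacingRows] at hr
    rw [Fintype.mem_piFinset]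
    intro i
    have := hr i
    have := i.2
    simp only [shiftedRow, Finset.mem_Ico, Fin.val_succ, Fin.val_castSucc]
    omega
  · intro ρ hρ
    rw [Fintype.mem_piFinset] at hρ
    rw [mem_interlacingRows]
    intro i
    have h1 := hρ i
    have := i.2
    simp only [shiftedRow, Finset.mem_Ico, Fin.val_succ, Fin.val_castSucc] at h1
    omega
  · intro r _
    funext i
    simp
  · intro ρ hρ
    rw [Fintype.mem_piFinset] at hρ
    funext i
    have h1 := hρ i
    have := i.2
    simp only [shiftedRow, Finset.mem_Ico, Fin.val_succ, Fin.val_castSucc] at h1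
    simp only
    omega
  · intro r _
    rw [← mul_assoc, ← Finset.prod_pow_eq_pow_sum, ← Finset.prod_mul_distrib]
    congr 1
    exact Finset.prod_congr rfl fun i _ => by rw [pow_add, mul_comm]

/-- The bialternant formula without denominators; the power of `q` passes by homogeneity to the
variables `q ^ (n - 1 - i)`. The branching rule proves it up to a constant common to all shapes, and
the empty shape, whose Schur polynomial is 1, fixes that constant. -/
theorem boundedSchur_principal {q : ℂ} (hq0 : q ≠ 0) (hq : ∀ j : ℕ, q ^ (j + 1) ≠ 1) (n : ℕ)
    {μ : YoungDiagram} (hμ : μ.colLen 0 ≤ n) :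
    q ^ ((n - 1) * μ.card) * boundedSchur n μ (fun i => (q ^ i)⁻¹) *
        (Matrix.vandermonde fun i : Fin n => q ^ (n - 1 - i : ℕ)).det =
      (Matrix.vandermonde fun i => q ^ shiftedRow n μ i).det := by
  induction n generalizing μ with
  | zero =>
    have : μ = ⊥ := eq_of_rowLen_eq fun i => by
      rw [rowLen_bot, rowLen_eq_zero (hμ.trans (Nat.zero_le i))]
    subst this
    simp [boundedSchur_bot]
  | succ n ih =>
    set C : ℂ := ∏ j : Fin n, (1 - q ^ (j + 1 : ℕ))⁻¹ with hC
    have hC0 : C ≠ 0 := Finset.prod_ne_zero_iff.2 fun j _ =>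
      inv_ne_zero (sub_ne_zero.2 (hq j).symm)
    set V := (Matrix.vandermonde fun i : Fin n => q ^ (n - 1 - i : ℕ)).det with hV
    set K := ∏ i : Fin n, q ^ (n - 1 - i : ℕ) with hK
    have step : ∀ ν : YoungDiagram, ν.colLen 0 ≤ n + 1 →
        K * (q ^ (n * ν.card) * boundedSchur (n + 1) ν (fun i => (q ^ i)⁻¹) * V) =
          C * (Matrix.vandermonde fun i => q ^ shiftedRow (n + 1) ν i).det := by
      intro ν hν
      rw [← sum_interlacingRows_det_vandermonde hq, boundedSchur_succ hν, Finset.mul_sum,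
        Finset.sum_mul]
      congr 1
      refine Finset.sum_congr rfl fun r hr => ?_
      have h1 := ih (colLen_diagramOfRows hr)
      have h2 : (fun i => q ^ shiftedRow n (diagramOfRows r) i) =
          fun i : Fin n => q ^ (r i + (n - 1 - i)) := by
        funext i
        rw [shiftedRow, rowLen_diagramOfRows hr, extendZero_of_lt]
      rw [h2] at h1
      rw [← h1, ← card_diagramOfRows hr]
      have h3 : q ^ (n * ν.card) * (q ^ n)⁻¹ ^ (ν.card - (diagramOfRows r).card) =
          q ^ (diagramOfRows r).card * q ^ ((n - 1) * (diagramOfRows r).card) := by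
        have h4 := card_diagramOfRows_le hν hr
        have h5 : n * ν.card = n * (ν.card - (diagramOfRows r).card) +
            n * (diagramOfRows r).card := by
          rw [← mul_add, Nat.sub_add_cancel h4]
        rw [← pow_add, h5, pow_add, inv_pow, ← pow_mul, mul_comm (q ^ _) (q ^ _), mul_assoc,
          mul_inv_cancel₀ (pow_ne_zero _ hq0), mul_one]
        -- For `n = 0` the exponent `n - 1` is truncated, but then the smaller diagram is empty.
        rcases Nat.eq_zero_or_pos n with hn | hn
        · subst hn
          rw [card_diagramOfRows hr]
          simp
        · congr 1
          obtain ⟨n, rfl⟩ := Nat.exists_eq_succ_of_ne_zero hn.ne'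
          simp only [Nat.succ_sub_one, Nat.succ_eq_add_one]
          ring
      linear_combination (boundedSchur n (diagramOfRows r) (fun i => (q ^ i)⁻¹) * V) * h3
    have h1 := step μ hμ
    have h2 := step ⊥ (by rw [colLen_zero_le (rowLen_bot 0) |> Nat.le_zero.1]; omega)
    have h3 : (fun i => q ^ shiftedRow (n + 1) ⊥ i) =
        fun i : Fin (n + 1) => q ^ (n + 1 - 1 - i : ℕ) :=
      funext fun i => by rw [shiftedRow_bot]
    rw [boundedSchur_bot, h3, YoungDiagram.card, YoungDiagram.cells_bot, Finset.card_empty,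
      mul_zero, pow_zero, one_mul, one_mul] at h2
    refine mul_left_cancel₀ hC0 ?_
    rw [← h1, Nat.add_sub_cancel]
    rw [Nat.add_sub_cancel] at h2
    linear_combination (- (q ^ (n * μ.card) *
      boundedSchur (n + 1) μ (fun i => (q ^ i)⁻¹))) * h2

/-! ### Schur polynomials as determinants in Frobenius coordinates -/

/-- A monomial of degree less than `n` is its own Lagrange interpolant at `n` nodes. -/
theorem vandermonde_eq_basis_mul {F : Type*} [Field F] {n : ℕ} {v : Fin n → F}
    (hv : Function.Injective v) (w : Fin n → F) :
    Matrix.vandermonde w =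
      (Matrix.of fun i j => (Lagrange.basis Finset.univ v j).eval (w i)) *
        Matrix.vandermonde v := by
  ext i c
  have h := Lagrange.eq_interpolate (f := (Polynomial.X ^ (c : ℕ) : Polynomial F))
    (s := Finset.univ) hv.injOn (by
      rw [Polynomial.degree_X_pow, Finset.card_univ, Fintype.card_fin]
      exact_mod_cast c.2)
  have h1 := congrArg (Polynomial.eval (w i)) h
  rw [Lagrange.interpolate_apply, Polynomial.eval_finsetSum] at h1
  simp only [Polynomial.eval_pow, Polynomial.eval_X, Polynomial.eval_mul,
    Polynomial.eval_C] at h1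
  rw [Matrix.vandermonde_apply, Matrix.mul_apply, h1]
  exact Finset.sum_congr rfl fun j _ => mul_comm _ _

/-- For a row `i` below the diagonal, `q ^ shiftedRow n μ i` is the node of index `i - μ_i`, so the
row is a unit vector. Permuting the columns by `frobeniusPerm` makes the matrix block triangular
with an identity block. The other block has evaluation points `q ^ (n + m_i)` and columns `n_j`. -/
theorem det_basis_shiftedRow {q : ℂ} (hq0 : q ≠ 0) (hq : ∀ j : ℕ, q ^ (j + 1) ≠ 1)
    (μ : YoungDiagram) {n : ℕ} (hμ : μ.colLen 0 ≤ n) :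
    (Matrix.of fun i j : Fin n => (Lagrange.basis Finset.univ
        (fun c : Fin n => q ^ (n - 1 - c : ℕ)) j).eval (q ^ shiftedRow n μ i)).det =
      (-1) ^ (∑ i, frobN μ i) * (Matrix.of fun i j : Fin (diagLen μ) =>
        (Lagrange.basis Finset.univ (fun c : Fin n => q ^ (n - 1 - c : ℕ))
          (frobeniusPerm μ hμ (Fin.castLE ((diagLen_le μ).trans hμ) j))).eval
            (q ^ (n + frobM μ i))).det := by
  have hk := (diagLen_le μ).trans hμ
  set v : Fin n → ℂ := fun c => q ^ (n - 1 - c : ℕ) with hv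
  have hvinj : Function.Injective v := fun i j h => by
    have h1 := pow_injective_of_forall_ne_one hq0 hq h
    exact Fin.ext (by omega)
  set M := Matrix.of fun i j : Fin n =>
    (Lagrange.basis Finset.univ v j).eval (q ^ shiftedRow n μ i) with hM
  have hM1 : M.det = (-1) ^ (∑ i, frobN μ i) *
      (M.submatrix id (frobeniusPerm μ hμ)).det := by
    rw [Matrix.det_permute', sign_frobeniusPerm, ← mul_assoc]
    push_cast
    rw [← pow_add, ← two_mul, pow_mul]
    simp
  have hrow : ∀ i j : Fin n, ¬ (i : ℕ) < diagLen μ →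
      M.submatrix id (frobeniusPerm μ hμ) i j = if i = j then 1 else 0 := by
    intro i j hi
    have h1 : q ^ shiftedRow n μ i = v (frobeniusPerm μ hμ i) := by
      simp only [hv, shiftedRow, coe_frobeniusPerm, frobeniusPermFun, if_neg hi]
      have := rowLen_le (not_lt.1 hi)
      have := i.2
      congr 1
      omega
    simp only [Matrix.submatrix_apply, id, hM, Matrix.of_apply]
    rw [h1]
    split_ifs with hij
    · rw [hij, Lagrange.eval_basis_self hvinj.injOn (Finset.mem_univ _)]
    · exact Lagrange.eval_basis_of_ne
        (fun h => hij ((frobeniusPerm μ hμ).injective h).symm) (Finset.mem_univ _)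
  rw [hM1, Matrix.twoBlockTriangular_det _ (fun i : Fin n => (i : ℕ) < diagLen μ)
    (fun i hi j hj => by rw [hrow i j hi, if_neg (by rintro rfl; exact hi hj)])]
  have h1 : ((M.submatrix id (frobeniusPerm μ hμ)).toSquareBlockProp
      fun i => ¬ (i : ℕ) < diagLen μ) = 1 := by
    ext i j
    rw [Matrix.toSquareBlockProp_def, Matrix.of_apply, hrow _ _ i.2, Matrix.one_apply]
    simp only [Subtype.ext_iff]
  let e : Fin (diagLen μ) ≃ {i : Fin n // (i : ℕ) < diagLen μ} :=
    { toFun := fun i => ⟨Fin.castLE hk i, i.2⟩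
      invFun := fun i => ⟨i.1, i.2⟩
      left_inv := fun i => rfl
      right_inv := fun i => rfl }
  rw [h1, Matrix.det_one, mul_one, ← Matrix.det_submatrix_equiv_self e]
  congr 2
  ext i j
  rw [Matrix.submatrix_apply, Matrix.toSquareBlockProp_def, Matrix.of_apply,
    Matrix.submatrix_apply, hM, Matrix.of_apply, Matrix.of_apply]
  have h2 : shiftedRow n μ (Fin.castLE hk i) = n + frobM μ i := by
    have := lt_rowLen i.2
    have := i.2
    simp only [shiftedRow, frobM, Fin.val_castLE]
    omega
  simp only [e, Equiv.coe_fn_mk, id, h2]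

/-- The hook Schur polynomial of the hook `(m | b)` in the variables `1, q⁻¹, …, q^{1 - n}`,
up to the sign `(-1) ^ b`. -/
def hookEntry (q : ℂ) (n m b : ℕ) : ℂ :=
  (q ^ ((n - 1) * (m + b + 1)))⁻¹ * ∏ j ∈ (Finset.range n).erase b,
    (q ^ (n + m) - q ^ (n - 1 - j)) / (q ^ (n - 1 - b) - q ^ (n - 1 - j))

theorem eval_basis_eq_prod (q : ℂ) {n : ℕ} (b : Fin n) (z : ℂ) :
    (Lagrange.basis Finset.univ (fun c : Fin n => q ^ (n - 1 - c : ℕ)) b).eval z =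
      ∏ j ∈ (Finset.range n).erase b,
        (z - q ^ (n - 1 - j)) / (q ^ (n - 1 - b : ℕ) - q ^ (n - 1 - j)) := by
  rw [Lagrange.basis, Polynomial.eval_prod]
  refine Finset.prod_nbij (fun c => (c : ℕ)) ?_ ?_ ?_ ?_
  · intro c hc
    simp only [Finset.mem_erase, Finset.mem_univ, and_true, Finset.mem_range] at hc ⊢
    exact ⟨fun h => hc (Fin.ext h), c.2⟩
  · exact Fin.val_injective.injOn
  · intro j hj
    simp only [Finset.coe_erase, Finset.coe_range, Set.mem_sdiff, Set.mem_Iio,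
      Set.mem_singleton_iff] at hj
    exact ⟨⟨j, hj.1⟩, by simpa [Fin.ext_iff] using hj.2, rfl⟩
  · intro c _
    rw [Lagrange.basisDivisor, Polynomial.eval_mul, Polynomial.eval_C, Polynomial.eval_sub,
      Polynomial.eval_X, Polynomial.eval_C, div_eq_mul_inv, mul_comm]

theorem det_mul_row_mul_column {R ι : Type*} [CommRing R] [Fintype ι] [DecidableEq ι]
    (a b : ι → R) (X : ι → ι → R) :
    (Matrix.of fun i j => a i * b j * X i j).det =
      (∏ i, a i * b i) * (Matrix.of X).det := by
  rw [Finset.prod_mul_distrib, mul_assoc, ← Matrix.det_mul_row, ← Matrix.det_mul_column]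
  simp only [Matrix.of_apply, mul_assoc]

/-- Since the size of `μ` is `∑ (m_i + n_i + 1)`, the power of `q` from the bialternant formula
splits into row and column factors, which `hookEntry` absorbs. -/
theorem boundedSchur_eq_det_hookEntry {q : ℂ} (hq0 : q ≠ 0) (hq : ∀ j : ℕ, q ^ (j + 1) ≠ 1)
    {μ : YoungDiagram} {n : ℕ} (hμ : μ.colLen 0 ≤ n) :
    boundedSchur n μ (fun i => (q ^ i)⁻¹) = (-1) ^ (∑ i, frobN μ i) *
      (Matrix.of fun i j => hookEntry q n (frobM μ i) (frobN μ j)).det := by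
  have h1 := boundedSchur_principal hq0 hq n hμ
  have hvinj : Function.Injective fun c : Fin n => q ^ (n - 1 - c : ℕ) := fun i j h => by
    have h1 := pow_injective_of_forall_ne_one hq0 hq h
    exact Fin.ext (by omega)
  rw [vandermonde_eq_basis_mul hvinj fun i => q ^ shiftedRow n μ i, Matrix.det_mul,
    det_basis_shiftedRow hq0 hq μ hμ] at h1
  have h2 := mul_right_cancel₀ (Matrix.det_vandermonde_ne_zero_iff.2 hvinj) h1
  have h3 : (Matrix.of fun i j => hookEntry q n (frobM μ i) (frobN μ j)) =
      Matrix.of fun i j : Fin (diagLen μ) =>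
        (q ^ ((n - 1) * (frobM μ i + 1)))⁻¹ * (q ^ ((n - 1) * frobN μ j))⁻¹ *
        (Lagrange.basis Finset.univ (fun c : Fin n => q ^ (n - 1 - c : ℕ))
          (frobeniusPerm μ hμ (Fin.castLE ((diagLen_le μ).trans hμ) j))).eval
            (q ^ (n + frobM μ i)) := by
    ext i j
    have h4 : (frobeniusPerm μ hμ (Fin.castLE ((diagLen_le μ).trans hμ) j) : ℕ) =
        frobN μ j := by
      rw [coe_frobeniusPerm, Fin.val_castLE, frobeniusPermFun, if_pos j.2, frobN]
    rw [Matrix.of_apply, Matrix.of_apply, hookEntry, eval_basis_eq_prod, h4, ← mul_inv,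
      ← pow_add, ← mul_add, add_right_comm]
  rw [h3, det_mul_row_mul_column, mul_left_comm, ← h2, ← mul_assoc]
  have h5 : (∏ i, (q ^ ((n - 1) * (frobM μ i + 1)))⁻¹ * (q ^ ((n - 1) * frobN μ i))⁻¹) =
      (q ^ ((n - 1) * μ.card))⁻¹ := by
    rw [card_eq_sum_frob, Finset.mul_sum, ← Finset.prod_pow_eq_pow_sum, ← Finset.prod_inv_distrib]
    refine Finset.prod_congr rfl fun i _ => ?_
    rw [← mul_inv, ← pow_add, ← mul_add, add_right_comm]
  rw [h5, inv_mul_cancel₀ (pow_ne_zero _ hq0), one_mul]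

/-! ### The limit of infinitely many variables -/

/-- With `N + (b + 1)` variables, `b` factors lie below the omitted index and `N` above it; only the
latter grow in number in the limit. -/
theorem erase_range_add_add_one (b N : ℕ) (f : ℕ → ℂ) :
    ∏ j ∈ (Finset.range (N + (b + 1))).erase b, f j =
      (∏ j ∈ Finset.range b, f j) * ∏ i ∈ Finset.range N, f (b + 1 + i) := by
  have h : (Finset.range (N + (b + 1))).erase b =
      Finset.range b ∪ (Finset.range N).map (addLeftEmbedding (b + 1)) := by
    ext j
    simp only [Finset.mem_erase, Finset.mem_range, Finset.mem_union, Finset.mem_map,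
      addLeftEmbedding_apply]
    constructor
    · rintro ⟨h1, h2⟩
      rcases lt_or_gt_of_ne h1 with h | h
      · exact Or.inl h
      · exact Or.inr ⟨j - (b + 1), by omega, by omega⟩
    · rintro (h | ⟨i, hi, rfl⟩)
      · omega
      · omega
  rw [h, Finset.prod_union, Finset.prod_map]
  · rfl
  · rw [Finset.disjoint_left]
    intro j hj hj'
    simp only [Finset.mem_map, Finset.mem_range, addLeftEmbedding_apply] at hj hj'
    omega

/-- Each of the `N + b` quotients releases a factor `q ^ (m + b + 1)`; together they cancel the
prefactor of `hookEntry`. -/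
theorem hookEntry_eq {q : ℂ} (hq0 : q ≠ 0) (hq : ∀ j : ℕ, q ^ (j + 1) ≠ 1) (N m b : ℕ) :
    hookEntry q (N + (b + 1)) m b =
      (∏ j ∈ Finset.range b, (1 - q⁻¹ ^ (m + 1 + j)) / (1 - q ^ (b - j))) *
        ∏ i ∈ Finset.range N, (1 - q⁻¹ ^ (m + b + 1 + (i + 1))) / (1 - q⁻¹ ^ (i + 1)) := by
  have h1 : ∀ j ∈ Finset.range b, (q ^ (N + (b + 1) + m) - q ^ (N + (b + 1) - 1 - j)) /
      (q ^ (N + (b + 1) - 1 - b) - q ^ (N + (b + 1) - 1 - j)) =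
      q ^ (m + b + 1) * ((1 - q⁻¹ ^ (m + 1 + j)) / (1 - q ^ (b - j))) := by
    intro j hj
    obtain ⟨c, rfl⟩ := Nat.exists_eq_add_of_lt (Finset.mem_range.1 hj)
    rw [show N + (j + c + 1 + 1) - 1 - j = N + (c + 1) by omega,
      show N + (j + c + 1 + 1) - 1 - (j + c + 1) = N by omega,
      show j + c + 1 - j = c + 1 by omega]
    have h0 : (1 : ℂ) - q ^ (c + 1) ≠ 0 := sub_ne_zero.2 (hq c).symm
    rw [pow_add q N (c + 1), ← mul_one_sub, inv_pow]
    field_simp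
    ring
  have h2 : ∀ i ∈ Finset.range N,
      (q ^ (N + (b + 1) + m) - q ^ (N + (b + 1) - 1 - (b + 1 + i))) /
      (q ^ (N + (b + 1) - 1 - b) - q ^ (N + (b + 1) - 1 - (b + 1 + i))) =
      q ^ (m + b + 1) * ((1 - q⁻¹ ^ (m + b + 1 + (i + 1))) / (1 - q⁻¹ ^ (i + 1))) := by
    intro i hi
    obtain ⟨c, rfl⟩ := Nat.exists_eq_add_of_lt (Finset.mem_range.1 hi)
    rw [show i + c + 1 + (b + 1) - 1 - (b + 1 + i) = c by omega,
      show i + c + 1 + (b + 1) - 1 - b = c + (i + 1) by omega]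
    have h0 : q ^ (i + 1) - 1 ≠ 0 := sub_ne_zero.2 (hq i)
    have h3 : (1 : ℂ) - (q ^ (i + 1))⁻¹ ≠ 0 := by
      rw [sub_ne_zero]
      exact fun h => hq i (inv_eq_one.1 h.symm)
    rw [pow_add q c (i + 1), ← mul_sub_one, inv_pow, inv_pow]
    rw [div_eq_iff (mul_ne_zero (pow_ne_zero _ hq0) h0)]
    field_simp
    ring
  rw [hookEntry, erase_range_add_add_one, Finset.prod_congr rfl h1, Finset.prod_congr rfl h2,
    Finset.prod_mul_distrib, Finset.prod_mul_distrib, Finset.prod_const, Finset.prod_const,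
    Finset.card_range, Finset.card_range, ← pow_mul, ← pow_mul, mul_mul_mul_comm, ← pow_add,
    ← mul_assoc, ← mul_add, show N + (b + 1) - 1 = b + N by omega, mul_comm (b + N),
    inv_mul_cancel₀ (pow_ne_zero _ hq0), one_mul]

/-- The product telescopes: its numerator and denominator share all but `c` factors. The `c` factors
left in the numerator tend to 1. -/
theorem tendsto_prod_one_sub_pow_div {t : ℂ} (ht : ‖t‖ < 1) (c : ℕ) :
    Filter.Tendsto (fun N => ∏ i ∈ Finset.range N, (1 - t ^ (c + (i + 1))) / (1 - t ^ (i + 1)))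
      Filter.atTop (nhds (∏ i ∈ Finset.range c, (1 - t ^ (i + 1)))⁻¹) := by
  have h0 : ∀ n : ℕ, ∏ i ∈ Finset.range n, (1 - t ^ (i + 1)) ≠ 0 := fun n =>
    Finset.prod_ne_zero_iff.2 fun i _ h => by
      have h1 : ‖t ^ (i + 1)‖ < 1 := by
        rw [norm_pow]
        exact pow_lt_one₀ (norm_nonneg _) ht (Nat.succ_ne_zero i)
      rw [← sub_eq_zero.1 h] at h1
      simp at h1
  have h1 : ∀ N, ∏ i ∈ Finset.range N, (1 - t ^ (c + (i + 1))) / (1 - t ^ (i + 1)) =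
      (∏ i ∈ Finset.range c, (1 - t ^ (i + 1)))⁻¹ *
        ∏ i ∈ Finset.range c, (1 - t ^ N * t ^ (i + 1)) := fun N => by
    have h2 := Finset.prod_range_add (fun i => 1 - t ^ (i + 1)) c N
    rw [add_comm, Finset.prod_range_add] at h2
    rw [Finset.prod_div_distrib, div_eq_iff (h0 N), mul_assoc, eq_inv_mul_iff_mul_eq₀ (h0 c)]
    simp only [add_assoc] at h2
    rw [← h2, mul_comm]
    simp only [pow_add]
  simp only [h1]
  have h3 : Filter.Tendsto (fun N : ℕ => ∏ i ∈ Finset.range c, (1 - t ^ N * t ^ (i + 1)))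
      Filter.atTop (nhds (∏ i ∈ Finset.range c, (1 - 0 * t ^ (i + 1)))) :=
    tendsto_finsetProd _ fun i _ =>
      ((tendsto_pow_atTop_nhds_zero_of_norm_lt_one ht).mul_const _).const_sub 1
  simpa using h3.const_mul (∏ i ∈ Finset.range c, (1 - t ^ (i + 1)))⁻¹

theorem tendsto_hookEntry {q : ℂ} (hq : 1 < ‖q‖) (m b : ℕ) :
    Filter.Tendsto (fun n => hookEntry q n m b) Filter.atTop
      (nhds ((∏ j ∈ Finset.range b, (1 - q ^ (j + 1))) *
        (∏ i ∈ Finset.range m, (1 - q⁻¹ ^ (i + 1))) * (1 - q⁻¹ ^ (m + b + 1)))⁻¹) := by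
  have hq0 : q ≠ 0 := norm_pos_iff.1 (zero_lt_one.trans hq)
  have hq1 : ∀ j : ℕ, q ^ (j + 1) ≠ 1 := fun j h => by
    have h1 : 1 < ‖q ^ (j + 1)‖ := by
      rw [norm_pow]
      exact one_lt_pow₀ hq (Nat.succ_ne_zero j)
    rw [h, norm_one] at h1
    exact lt_irrefl _ h1
  have ht0 : ∀ j : ℕ, (1 : ℂ) - q⁻¹ ^ (j + 1) ≠ 0 := fun j h => hq1 j (by
    rw [inv_pow] at h
    exact inv_eq_one.1 (sub_eq_zero.1 h).symm)
  have ht : ‖q⁻¹‖ < 1 := by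
    rw [norm_inv]
    exact inv_lt_one_of_one_lt₀ hq
  rw [← Filter.tendsto_add_atTop_iff_nat (b + 1)]
  simp only [hookEntry_eq hq0 hq1]
  convert (tendsto_prod_one_sub_pow_div ht (m + b + 1)).const_mul _ using 2
  have h1 : ∏ j ∈ Finset.range b, (1 - q ^ (b - j)) = ∏ j ∈ Finset.range b, (1 - q ^ (j + 1)) := by
    rw [← Finset.prod_range_reflect]
    refine Finset.prod_congr rfl fun j hj => ?_
    have := Finset.mem_range.1 hj
    congr 2
    omega
  have h2 : ∏ j ∈ Finset.range b, (1 - q⁻¹ ^ (m + 1 + j)) =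
      ∏ j ∈ Finset.range b, (1 - q⁻¹ ^ (m + j + 1)) :=
    Finset.prod_congr rfl fun j _ => by rw [add_right_comm]
  have h3 : ∏ j ∈ Finset.range b, (1 - q⁻¹ ^ (m + j + 1)) ≠ 0 :=
    Finset.prod_ne_zero_iff.2 fun j _ => ht0 _
  -- The `m + b + 1` factors of the limit split as `m`, `b` and `1`; the middle `b` cancel the
  -- numerator from `hookEntry_eq`.
  rw [Finset.prod_div_distrib, h1, h2, Finset.prod_range_succ, Finset.prod_range_add,
    div_eq_mul_inv]
  simp only [mul_inv]
  linear_combination (-((∏ j ∈ Finset.range b, (1 - q ^ (j + 1)))⁻¹ *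
    (∏ i ∈ Finset.range m, (1 - q⁻¹ ^ (i + 1)))⁻¹ * (1 - q⁻¹ ^ (m + b + 1))⁻¹)) *
    mul_inv_cancel₀ h3

/-- A finite set of functions lies in a finite box, over which the sum of products is a product of
sums. -/
theorem summable_prod_pi {ι : Type*} [Fintype ι] {f : ℕ → ℝ} (h0 : ∀ i, 0 ≤ f i)
    (hf : Summable f) : Summable fun g : ι → ℕ => ∏ i, f (g i) := by
  classical
  refine summable_of_sum_le (c := ∏ _i : ι, ∑' n, f n)
    (fun g => Finset.prod_nonneg fun i _ => h0 _) fun u => ?_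
  calc ∑ g ∈ u, ∏ i, f (g i)
      ≤ ∑ g ∈ Fintype.piFinset fun i => u.image fun g => g i, ∏ i, f (g i) :=
        Finset.sum_le_sum_of_subset_of_nonneg
          (fun g hg => Fintype.mem_piFinset.2 fun i => Finset.mem_image_of_mem _ hg)
          fun g _ _ => Finset.prod_nonneg fun i _ => h0 _
    _ = ∏ i, ∑ n ∈ u.image fun g => g i, f n := (Finset.prod_univ_sum _ fun _ n => f n).symm
    _ ≤ ∏ _i : ι, ∑' n, f n :=
        Finset.prod_le_prod (fun i _ => Finset.sum_nonneg fun n _ => h0 n)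
          fun i _ => hf.sum_le_tsum _ fun n _ => h0 n

theorem summable_tableauWeight {x : ℕ → ℂ} (hx : Summable fun i => ‖x i‖) (μ : YoungDiagram) :
    Summable fun T : SemistandardYoungTableau μ => tableauWeight x T := by
  have h1 := summable_prod_pi (ι := {c // c ∈ μ.cells}) (fun i => norm_nonneg (x i)) hx
  have h2 : Function.Injective fun (T : SemistandardYoungTableau μ) (c : {c // c ∈ μ.cells}) =>
      T c.1.1 c.1.2 := fun T T' h => by
    ext i j
    by_cases hij : (i, j) ∈ μ
    · exact congrFun h ⟨(i, j), hij⟩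
    · rw [T.zeros hij, T'.zeros hij]
  refine Summable.of_norm ((h1.comp_injective h2).congr fun T => ?_)
  rw [tableauWeight, norm_prod, ← Finset.prod_coe_sort]
  rfl

/-- A tableau has finitely many cells, so the sets of tableaux with entries below `n` exhaust all
tableaux. -/
theorem tendsto_boundedSchur {x : ℕ → ℂ} (hx : Summable fun i => ‖x i‖) (μ : YoungDiagram) :
    Filter.Tendsto (fun n => boundedSchur n μ x) Filter.atTop (nhds (schurEval μ x)) := by
  let s : ℕ → Finset (SemistandardYoungTableau μ) := fun n =>
    (Finset.univ : Finset (BoundedTableau n μ)).map (Function.Embedding.subtype _)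
  have hs : ∀ n T, T ∈ s n ↔ ∀ i j, (i, j) ∈ μ → T i j < n := fun n T => by
    simp [s]
  have hmono : Monotone s := fun n n' hn T hT => by
    rw [hs] at hT ⊢
    exact fun i j h => (hT i j h).trans_le hn
  have htop : Filter.Tendsto s Filter.atTop Filter.atTop := by
    refine hmono.tendsto_atTop_finset fun T => ?_
    obtain ⟨N, hN⟩ := (μ.cells.image fun c => T c.1 c.2).bddAbove
    refine ⟨N + 1, (hs _ _).2 fun i j h => Nat.lt_succ_of_le (hN ?_)⟩
    exact Finset.mem_coe.2 (Finset.mem_image_of_mem (fun c : ℕ × ℕ => T c.1 c.2) h)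
  have h := (summable_tableauWeight hx μ).hasSum.comp htop
  refine h.congr fun n => ?_
  simp only [Function.comp_apply, s, Finset.sum_map, boundedSchur]
  rfl

/-- Used with `u = q^{-1/2}`, which carries the sequence `q^{-i}` to `q^ρ`. -/
theorem boundedSchur_smul (n : ℕ) (μ : YoungDiagram) (u : ℂ) (x : ℕ → ℂ) :
    boundedSchur n μ (fun i => u * x i) = u ^ μ.card * boundedSchur n μ x := by
  simp only [boundedSchur, tableauWeight, Finset.prod_mul_distrib, Finset.prod_const,
    Finset.mul_sum]

/-! ### The specialization at `q ^ ρ` -/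

theorem qpow_add (ℓ y z : ℂ) : qpow ℓ (y + z) = qpow ℓ y * qpow ℓ z := by
  rw [qpow, add_mul, Complex.exp_add, qpow, qpow]

theorem qpow_neg (ℓ z : ℂ) : qpow ℓ (-z) = (qpow ℓ z)⁻¹ := by
  rw [qpow, neg_mul, Complex.exp_neg, qpow]

theorem qpow_ne_zero (ℓ z : ℂ) : qpow ℓ z ≠ 0 := Complex.exp_ne_zero _

theorem qpow_natCast (ℓ : ℂ) (n : ℕ) : qpow ℓ n = Complex.exp ℓ ^ n := by
  rw [qpow, Complex.exp_nat_mul]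

theorem qpow_natCast_mul (ℓ : ℂ) (n : ℕ) (z : ℂ) : qpow ℓ (n * z) = qpow ℓ z ^ n := by
  rw [qpow, mul_assoc, Complex.exp_nat_mul, qpow]

theorem qpow_sum {ι : Type*} (s : Finset ι) (ℓ : ℂ) (f : ι → ℂ) :
    qpow ℓ (∑ i ∈ s, f i) = ∏ i ∈ s, qpow ℓ (f i) := by
  rw [qpow, Finset.sum_mul, Complex.exp_sum]
  rfl

theorem qRho_eq (ℓ : ℂ) (i : ℕ) :
    qRho ℓ i = qpow ℓ (-(1 / 2)) * (Complex.exp ℓ ^ i)⁻¹ := by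
  rw [qRho, ← qpow_natCast, ← qpow_neg, ← qpow_add]
  congr 1
  ring

theorem summable_norm_qRho {ℓ : ℂ} (hq : 1 < ‖Complex.exp ℓ‖) :
    Summable fun i => ‖qRho ℓ i‖ := by
  simp only [qRho_eq, norm_mul, ← inv_pow, norm_pow, norm_inv]
  exact (summable_geometric_of_lt_one (inv_nonneg.2 (norm_nonneg _))
    (inv_lt_one_of_one_lt₀ hq)).mul_left _

theorem one_sub_inv_pow_eq (ℓ : ℂ) (k : ℕ) :
    1 - (Complex.exp ℓ)⁻¹ ^ k = qpow ℓ (-(k / 2)) * qBracket ℓ k := by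
  rw [qBracket, mul_sub, ← qpow_add, ← qpow_add, inv_pow, ← qpow_natCast, ← qpow_neg]
  congr 1
  · rw [neg_add_cancel, qpow, zero_mul, Complex.exp_zero]
  · congr 1
    ring

theorem one_sub_pow_eq (ℓ : ℂ) (k : ℕ) :
    1 - Complex.exp ℓ ^ k = -1 * qpow ℓ (k / 2) * qBracket ℓ k := by
  rw [qBracket, mul_sub, mul_assoc, mul_assoc, ← qpow_add, ← qpow_add, ← qpow_natCast,
    add_neg_cancel, show qpow ℓ 0 = 1 by rw [qpow, zero_mul, Complex.exp_zero], add_halves]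
  ring

theorem sum_range_add_one_div_two (b : ℕ) :
    ∑ j ∈ Finset.range b, ((j + 1 : ℕ) : ℂ) / 2 = (b : ℂ) * (b + 1) / 4 := by
  induction b with
  | zero => simp
  | succ b ih =>
    rw [Finset.sum_range_succ, ih]
    push_cast
    ring

theorem prod_one_sub_pow_eq (ℓ : ℂ) (b : ℕ) :
    ∏ j ∈ Finset.range b, (1 - Complex.exp ℓ ^ (j + 1)) =
      (-1) ^ b * qpow ℓ ((b : ℂ) * (b + 1) / 4) * qFactorial ℓ b := by
  simp only [one_sub_pow_eq, Finset.prod_mul_distrib, Finset.prod_const, Finset.card_range,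
    ← qpow_sum, sum_range_add_one_div_two, qFactorial]

theorem prod_one_sub_inv_pow_eq (ℓ : ℂ) (m : ℕ) :
    ∏ i ∈ Finset.range m, (1 - (Complex.exp ℓ)⁻¹ ^ (i + 1)) =
      qpow ℓ (-((m : ℂ) * (m + 1) / 4)) * qFactorial ℓ m := by
  simp only [one_sub_inv_pow_eq, Finset.prod_mul_distrib, ← qpow_sum, Finset.sum_neg_distrib,
    sum_range_add_one_div_two, qFactorial]

/-- Identifies the limit in `tendsto_hookEntry`, up to the power `q^{-1/2}` per cell of the hook.
Passing to symmetric brackets costs `q^{b(b+1)/4}` and `q^{-m(m+1)/4}`, whose inverses make up the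
prefactor at `a = 0`. -/
theorem vertexCoeff_zero_eq (ℓ : ℂ) (m b : ℕ) :
    vertexCoeff ℓ 0 m b = qpow ℓ (-((m + b + 1 : ℕ) / 2)) *
      ((∏ j ∈ Finset.range b, (1 - Complex.exp ℓ ^ (j + 1))) *
        (∏ i ∈ Finset.range m, (1 - (Complex.exp ℓ)⁻¹ ^ (i + 1))) *
        (1 - (Complex.exp ℓ)⁻¹ ^ (m + b + 1)))⁻¹ := by
  rw [prod_one_sub_pow_eq, prod_one_sub_inv_pow_eq, one_sub_inv_pow_eq, vertexCoeff]
  have h1 : qpow ℓ ((2 * 0 + 1) * ((m : ℂ) - b) * ((m : ℂ) + b + 1) / 4) =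
      (qpow ℓ ((b : ℂ) * (b + 1) / 4))⁻¹ * (qpow ℓ (-((m : ℂ) * (m + 1) / 4)))⁻¹ := by
    rw [← qpow_neg, ← qpow_neg, ← qpow_add]
    congr 1
    ring
  have h2 : ((-1 : ℂ) ^ b)⁻¹ = (-1) ^ b := by
    rw [← inv_pow]
    norm_num
  have h3 := mul_inv_cancel₀ (qpow_ne_zero ℓ (-((m + b + 1 : ℕ) / 2)))
  rw [h1, div_eq_mul_inv]
  simp only [mul_inv, h2]
  linear_combination (-((-1) ^ b * (qpow ℓ ((b : ℂ) * (b + 1) / 4))⁻¹ *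
    (qpow ℓ (-((m : ℂ) * (m + 1) / 4)))⁻¹ * (qBracket ℓ (m + b + 1))⁻¹ * (qFactorial ℓ m)⁻¹ *
    (qFactorial ℓ b)⁻¹)) * h3

/-- The exponent separates because `(m - b)(m + b + 1) = m(m + 1) - b(b + 1)`. -/
theorem vertexCoeff_eq (ℓ a : ℂ) (m b : ℕ) :
    vertexCoeff ℓ a m b = qpow ℓ (a * (m * (m + 1)) / 2) * qpow ℓ (-(a * (b * (b + 1)) / 2)) *
      vertexCoeff ℓ 0 m b := by
  rw [vertexCoeff, vertexCoeff, ← qpow_add, ← mul_div_assoc, mul_left_comm, ← qpow_add]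
  congr 3
  ring

theorem det_vertexCoeff (ℓ a : ℂ) (μ : YoungDiagram) :
    (Matrix.of fun i j => vertexCoeff ℓ a (frobM μ i) (frobN μ j)).det =
      qpow ℓ (a * (kappa μ : ℂ) / 2) *
        (Matrix.of fun i j => vertexCoeff ℓ 0 (frobM μ i) (frobN μ j)).det := by
  simp only [fun i j => vertexCoeff_eq ℓ a (frobM μ i) (frobN μ j)]
  rw [det_mul_row_mul_column, kappa_eq_sum_frob]
  congr 1
  push_cast
  rw [Finset.mul_sum, Finset.sum_div, qpow_sum]
  refine Finset.prod_congr rfl fun i _ => ?_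
  rw [← qpow_add]
  congr 1
  ring

/-- The Giambelli formula for `s_μ(q^ρ)`. -/
theorem schurEval_qRho {ℓ : ℂ} (hq : 1 < ‖Complex.exp ℓ‖) (μ : YoungDiagram) :
    schurEval μ (qRho ℓ) = (-1) ^ (∑ i, frobN μ i) *
      (Matrix.of fun i j => vertexCoeff ℓ 0 (frobM μ i) (frobN μ j)).det := by
  have hq0 : Complex.exp ℓ ≠ 0 := Complex.exp_ne_zero ℓ
  have hq1 : ∀ j : ℕ, Complex.exp ℓ ^ (j + 1) ≠ 1 := fun j h => by
    have h1 : 1 < ‖Complex.exp ℓ ^ (j + 1)‖ := by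
      rw [norm_pow]
      exact one_lt_pow₀ hq (Nat.succ_ne_zero j)
    rw [h, norm_one] at h1
    exact lt_irrefl _ h1
  refine tendsto_nhds_unique (tendsto_boundedSchur (summable_norm_qRho hq) μ) ?_
  have h1 : ∀ n, μ.colLen 0 ≤ n → boundedSchur n μ (qRho ℓ) =
      (-1) ^ (∑ i, frobN μ i) * (Matrix.of fun i j => qpow ℓ (-((frobM μ i + 1 : ℕ) / 2)) *
        qpow ℓ (-(frobN μ j / 2)) *
        hookEntry (Complex.exp ℓ) n (frobM μ i) (frobN μ j)).det := fun n hn => by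
    rw [funext (qRho_eq ℓ), boundedSchur_smul, boundedSchur_eq_det_hookEntry hq0 hq1 hn,
      det_mul_row_mul_column, mul_left_comm]
    congr 2
    rw [card_eq_sum_frob, ← Finset.prod_pow_eq_pow_sum]
    refine Finset.prod_congr rfl fun i _ => ?_
    rw [← qpow_natCast_mul, ← qpow_add]
    congr 1
    push_cast
    ring
  refine Filter.Tendsto.congr' (Filter.eventually_atTop.2 ⟨_, fun n hn => (h1 n hn).symm⟩) ?_
  -- The size of the matrix does not depend on `n`, so continuity of the determinant reduces the
  -- limit to the entries.
  refine Filter.Tendsto.const_mul _ (((Continuous.matrix_det continuous_id).tendsto _).comp ?_)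
  refine tendsto_pi_nhds.2 fun i => tendsto_pi_nhds.2 fun j => ?_
  have h2 := (tendsto_hookEntry hq (frobM μ i) (frobN μ j)).const_mul
    (qpow ℓ (-((frobM μ i + 1 : ℕ) / 2)) * qpow ℓ (-(frobN μ j / 2)))
  have h3 : qpow ℓ (-((frobM μ i + frobN μ j + 1 : ℕ) / 2)) =
      qpow ℓ (-((frobM μ i + 1 : ℕ) / 2)) * qpow ℓ (-(frobN μ j / 2)) := by
    rw [← qpow_add]
    congr 1
    push_cast
    ring
  rw [← (vertexCoeff_zero_eq ℓ (frobM μ i) (frobN μ j)).trans (congrArg (· * _) h3)] at h2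
  exact h2

/-! ### Comparison of the two states coefficient by coefficient -/

theorem vertexState_partitionSet (ℓ a : ℂ) (μ : YoungDiagram) :
    vertexState ℓ a (partitionSet μ) =
      qpow ℓ (a * (kappa μ : ℂ) / 2) * schurEval μ (qRho ℓ) := by
  rw [vertexState, finsum_eq_single _ μ]
  · simp [ket]
  · intro ν hν
    simp [ket, partitionSet_injective.ne hν]

theorem vertexState_mem_chargeZero (ℓ a : ℂ) : vertexState ℓ a ∈ chargeZero := by
  intro A hA
  by_contra h
  obtain ⟨μ, hμ⟩ := exists_ne_zero_of_finsum h
  refine hA ?_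
  have : partitionSet μ = A := by
    by_contra hne
    simp [ket, hne] at hμ
  rw [← this, charge_partitionSet]

theorem bra_expOp_vac (c : ℕ → ℕ → ℂ) (μ : YoungDiagram) :
    bra μ (expOp (quadOp c) (vac : CompletedFock)) = (-1) ^ (∑ i, frobN μ i) *
      (Matrix.of fun i j => c (frobM μ i) (frobN μ j)).det := by
  rw [bra, partitionSet_eq_frobeniusSet,
    expOp_quadOp_vac_frobeniusSet c (frobM_strictAnti μ) (frobN_strictAnti μ)]

theorem qpow_kappa_mul_schurEval {ℓ : ℂ} (hq : 1 < ‖Complex.exp ℓ‖) (a : ℂ) (μ : YoungDiagram) :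
    qpow ℓ (a * (kappa μ : ℂ) / 2) * schurEval μ (qRho ℓ) =
      bra μ (expOp (quadOp (vertexCoeff ℓ a)) (vac : CompletedFock)) := by
  rw [bra_expOp_vac, det_vertexCoeff, schurEval_qRho hq, mul_left_comm]

end FramedVertex

end

open FramedVertex
theorem mainTheorem1 (q ℓ a : ℂ) (hq : 1 < ‖q‖) (hℓ : Complex.exp ℓ = q) :
    (∀ μ : YoungDiagram, Summable
      (fun T : SemistandardYoungTableau μ => tableauWeight (qRho ℓ) T)) ∧
    vertexState ℓ a ∈ chargeZero ∧
    vertexState ℓ a = expOp (quadOp (vertexCoeff ℓ a)) (vac : AdmissibleSet → ℂ) ∧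
    (∀ μ : YoungDiagram,
      qpow ℓ (a * (kappa μ : ℂ) / 2) * schurEval μ (qRho ℓ) =
        bra μ (expOp (quadOp (vertexCoeff ℓ a)) (vac : AdmissibleSet → ℂ))) ∧
    (∀ μ : YoungDiagram,
      bra μ (expOp (quadOp (vertexCoeff ℓ a)) (vac : AdmissibleSet → ℂ)) =
        (-1) ^ (∑ i, frobN μ i) *
          (Matrix.of fun i j => vertexCoeff ℓ a (frobM μ i) (frobN μ j)).det) := by
  subst hℓ
  refine ⟨summable_tableauWeight (summable_norm_qRho hq), vertexState_mem_chargeZero ℓ a,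
    funext fun A => ?_, qpow_kappa_mul_schurEval hq a, bra_expOp_vac _⟩
  -- In charge 0 every basis vector is some `|μ⟩`; in any other charge both coefficients vanish.
  by_cases hA : A.charge = 0
  · obtain ⟨μ, rfl⟩ := exists_partitionSet_eq hA
    rw [vertexState_partitionSet, qpow_kappa_mul_schurEval hq, bra]
  · rw [vertexState_mem_chargeZero ℓ a A hA,
      expOp_quadOp_mem_chargeZero _ vac_mem_chargeZero A hA]
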